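/- Let $(u,v)$ be affine coordinates of the complex projective plane around the point $p=(0,0)$, let $R=\mathcal{O}_{\mathbb{P}^2,p}$ and let $F=\mathbb{C}(u,v)$ be its fraction field. Let $\pi:X_n\to X_{n-1}\to\cdots\to X_0=\mathbb{P}^2$ ($n\ge 1$) be a finite sequence of point blow-ups with centers $p_1=p,p_2,\dots,p_n$, where each $p_{i+1}$ lies on the exceptional curve $E_i$ of the blow-up of $p_i$, and let $\nu=\mathrm{ord}_{E_n}$ be the divisorial valuation of $F$ given by the order of vanishing along the last exceptional curve $E_n$. Write: - $\bar\beta_{g+1}(\nu)=\nu(\varphi_n)$, where $g$ is the number of Puiseux pairs of $\nu$ and $\varphi_n\in R$ is analytically irreducible and defines a germ whose strict transform on $X_n$ is non-singular and meets $E_n$ transversally at a general point (a point of $E_n$ on no other exceptional curve); the value does not depend on the choice of $\varphi_n$; - $\mathrm{vol}(\nu)=\lim_{\alpha\to\infty}\dim_{\mathbb{C}}(R/\mathcal{P}_\alpha)/(\alpha^2/2)$, where $\mathcal{P}_\alpha=\{f\in R\mid \nu(f)\ge\alpha\}\cup\{0\}$; - $\hat\mu(\nu)=\lim_{d\to\infty}\frac1d\max\{\nu(f)\mid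 0\ne f\in\mathbb{C}[u,v],\ \deg f\le d\}$. The valuation $\nu$ is called minimal if $\hat\mu(\nu)=\sqrt{1/\mathrm{vol}(\nu)}$. An element $\varphi_n$ as above and the two limits exist, and the following holds. 1. If $f\in\mathbb{C}[u,v]$ is irreducible and $\nu(f)>\sqrt{\bar\beta_{g+1}(\nu)}\,\deg f$, then $\nu(f)/\deg f=\hat\mu(\nu)$. 2. If $\nu$ is not minimal, then there is an irreducible $f\in\mathbb{C}[u,v]$ with $\nu(f)>\sqrt{\bar\beta_{g+1}(\nu)}\,\deg f$ (hence $\nu(f)/\deg f=\hat\mu(\nu)$), and it is unique up to multiplication by a non-zero constant: every irreducible $h\in\mathbb{C}[u,v]$ with $\nu(h)>\sqrt{\bar\beta_{g+1}(\nu)}\,\deg h$, or with $\nu(h)/\deg h=\hat\mu(\nu)$, is of the form $h=cf$ with $c\in\mathbb{C}\setminus\{0\}$. The curve $f=0$ is called the supraminimal curve of $\nu$. -/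

import Mathlib

open MvPolynomial Filter Topology

noncomputable section

namespace PlaneVal

/-- The coordinate ring `ℂ[u, v]` of an affine plane: `u = X 0`, `v = X 1`. -/
abbrev Plane : Type := MvPolynomial (Fin 2) ℂ

/-- The function field `F = ℂ(u, v)` of the plane. -/
abbrev FunField : Type := FractionRing Plane

/-- The maximal ideal of the point `p = (0, 0)` in `ℂ[u, v]`. -/
def originIdeal : Ideal Plane := RingHom.ker (constantCoeff : Plane →+* ℂ)

instance : originIdeal.IsPrime := RingHom.ker_isPrime _

/-- The local ring `R` of the plane at `p = (0, 0)`, as a subring of the function field: the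
fractions `a / s` with `a, s ∈ ℂ[u, v]` and `s(0, 0) ≠ 0`. -/
def localRing : Subalgebra Plane FunField :=
  Localization.subalgebra.ofField FunField originIdeal.primeCompl
    originIdeal.primeCompl_le_nonZeroDivisors

/-! ### Point blow-ups in coordinates -/

/-- The points of the exceptional curve (a projective line) of the blow-up of the origin of a
plane with coordinates `(u, v)`: the direction `v = c u` for `c : ℂ`, and the direction `u = 0`. -/
inductive ExcPoint : Type
  | slope (c : ℂ)
  | vertical

/-- The blow-up of the origin, in local coordinates `(x, y) = (X 0, X 1)` of the blown-up surface
centred at the given point of the exceptional curve. For every point the exceptional curve is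
`x = 0`. For the direction `v = c u` the blow-up is `(u, v) = (x, x (y + c))`, and for
the direction `u = 0` it is `(u, v) = (x y, x)`. -/
def chart : ExcPoint → Plane →ₐ[ℂ] Plane
  | .slope c => aeval ![X 0, X 0 * (X 1 + C c)]
  | .vertical => aeval ![X 0 * X 1, X 0]

/-- The composition of the blow-ups at the origins of successive charts; the head of the list is
the point chosen on the first exceptional curve. -/
def pullback : List ExcPoint → Plane →ₐ[ℂ] Plane
  | [] => AlgHom.id ℂ Plane
  | t :: ts => (pullback ts).comp (chart t)

/-- The strict transform, under the blow-up of the origin and in the chart centred at `t`, of the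
curve germ `f = 0`: all factors `x` (the exceptional curve) are divided out of the total
transform of `f`. -/
def strictStep (t : ExcPoint) (f : Plane) : Plane :=
  MvPolynomial.divMonomial (chart t f) (Finsupp.single 0 (multiplicity (X 0) (chart t f)))

/-- The iterated strict transform along a list of points. -/
def strictTransform : List ExcPoint → Plane → Plane
  | [], f => f
  | t :: ts, f => strictTransform ts (strictStep t f)

/-- A finite simple sequence of point blow-ups starting at `p₁ = p`, with centres `p₁, …, pₙ`,
`n ≥ 1`, where each `pᵢ₊₁` is a point of the exceptional curve `Eᵢ` of the blow-up of `pᵢ`.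
It is given by the list `[p₂, …, pₙ]`, of length `n - 1`, each `pᵢ₊₁` being described by its
position on `Eᵢ ≅ ℙ¹` with respect to the chart of the previous steps centred at `pᵢ`. -/
structure Cluster : Type where
  /-- The centres `p₂, …, pₙ`. -/
  points : List ExcPoint

/-! ### The divisorial valuation -/

theorem constantCoeff_chart (t : ExcPoint) (f : Plane) :
    constantCoeff (chart t f) = constantCoeff f := by
  have : (constantCoeff.comp (chart t).toRingHom : Plane →+* ℂ) = constantCoeff := by
    apply MvPolynomial.ringHom_ext
    · intro r
      cases t <;> simp [chart]
    · intro i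
      cases t <;> fin_cases i <;> simp [chart]
  exact congrArg (fun g : Plane →+* ℂ => g f) this

theorem constantCoeff_pullback (l : List ExcPoint) (f : Plane) :
    constantCoeff (pullback l f) = constantCoeff f := by
  induction l generalizing f with
  | nil => rfl
  | cons t ts ih => exact (ih (chart t f)).trans (constantCoeff_chart t f)

/-- The blow-up is birational: the chart has an inverse over the function field. -/
theorem chart_injective (t : ExcPoint) : Function.Injective (chart t) := by
  have hX : ∀ i, algebraMap Plane FunField (X i) ≠ 0 := fun i h =>
    MvPolynomial.X_ne_zero (R := ℂ) i (IsFractionRing.injective Plane FunField (h.trans (map_zero _).symm))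
  have key : ∃ g : Plane →ₐ[ℂ] FunField, ∀ f, g (chart t f) = algebraMap Plane FunField f := by
    cases t with
    | slope c =>
      refine ⟨aeval ![algebraMap Plane FunField (X 0), algebraMap Plane FunField (X 1) /
        algebraMap Plane FunField (X 0) - algebraMap ℂ FunField c], fun f => ?_⟩
      have : (aeval ![algebraMap Plane FunField (X 0), algebraMap Plane FunField (X 1) /
          algebraMap Plane FunField (X 0) - algebraMap ℂ FunField c] :
            Plane →ₐ[ℂ] FunField).comp (chart (.slope c)) =
          IsScalarTower.toAlgHom ℂ Plane FunField := by
        apply MvPolynomial.algHom_ext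
        intro i
        have := hX 0
        fin_cases i
        · simp [chart]
        · simp [chart]
          field_simp
      exact congrArg (fun g : Plane →ₐ[ℂ] FunField => g f) this
    | vertical =>
      refine ⟨aeval ![algebraMap Plane FunField (X 1), algebraMap Plane FunField (X 0) /
        algebraMap Plane FunField (X 1)], fun f => ?_⟩
      have : (aeval ![algebraMap Plane FunField (X 1), algebraMap Plane FunField (X 0) /
          algebraMap Plane FunField (X 1)] :
            Plane →ₐ[ℂ] FunField).comp (chart .vertical) =
          IsScalarTower.toAlgHom ℂ Plane FunField := by
        apply MvPolynomial.algHom_ext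
        intro i
        have := hX 1
        fin_cases i
        · simp [chart]
          field_simp
        · simp [chart]
      exact congrArg (fun g : Plane →ₐ[ℂ] FunField => g f) this
  obtain ⟨g, hg⟩ := key
  intro a b hab
  apply IsFractionRing.injective Plane FunField
  rw [← hg, ← hg, hab]

theorem pullback_injective (l : List ExcPoint) : Function.Injective (pullback l) := by
  induction l with
  | nil => exact fun a b h => h
  | cons t ts ih => exact fun a b h => chart_injective t (ih h)

/-- The inclusion of the values `ℕ ∪ {∞}` into `ℤ ∪ {∞}`. -/
def enatToInt : ℕ∞ →+ WithTop ℤ :=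
  (Nat.castAddMonoidHom ℤ).withTopMap

theorem enatToInt_monotone : Monotone enatToInt :=
  WithTop.monotone_map_iff.2 fun a b h => by simpa using h

theorem enatToInt_nonneg (n : ℕ∞) : 0 ≤ enatToInt n := by
  have h : enatToInt 0 ≤ enatToInt n := enatToInt_monotone bot_le
  rwa [map_zero] at h

/-- The order of vanishing along the last exceptional curve `Eₙ`, on `ℂ[u, v]`. After blowing up
`pₙ`, the curve `Eₙ` is `x = 0` in the chart centred at the point `slope 0` of `Eₙ`. -/
def Cluster.polyVal (K : Cluster) : AddValuation Plane (WithTop ℤ) :=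
  ((multiplicity_addValuation (X_prime (i := (0 : Fin 2)) (R := ℂ))).comap
    (pullback (K.points ++ [.slope 0])).toRingHom).map enatToInt rfl enatToInt_monotone

theorem Cluster.polyVal_apply (K : Cluster) (f : Plane) :
    K.polyVal f = enatToInt (emultiplicity (X 0) (pullback (K.points ++ [.slope 0]) f)) := rfl

theorem Cluster.polyVal_ne_top (K : Cluster) {f : Plane} (hf : f ≠ 0) : K.polyVal f ≠ ⊤ := by
  rw [Cluster.polyVal_apply]
  have h0 : pullback (K.points ++ [.slope 0]) f ≠ 0 := by
    rw [Ne, map_eq_zero_iff _ (pullback_injective _)]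
    exact hf
  have hfin : FiniteMultiplicity (X 0 : Plane) (pullback (K.points ++ [.slope 0]) f) :=
    FiniteMultiplicity.of_prime_left X_prime h0
  rw [hfin.emultiplicity_eq_multiplicity]
  exact WithTop.coe_ne_top

/-- The divisorial valuation of the cluster: the order of vanishing along the last exceptional
curve `Eₙ`, a valuation of the function field `F` with value group `ℤ` (and value `⊤` at `0`).
It is the extension to fractions of the order of vanishing of polynomials. -/
def Cluster.val (K : Cluster) : AddValuation FunField (WithTop ℤ) :=
  AddValuation.ofValuation
    (Valuation.extendToLocalization (Γ := Multiplicative (WithTop ℤ)ᵒᵈ)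
      (AddValuation.toValuation K.polyVal) (S := nonZeroDivisors Plane)
      (fun _ hf h => K.polyVal_ne_top (nonZeroDivisors.ne_zero hf) h) FunField)

theorem Cluster.val_algebraMap (K : Cluster) (f : Plane) :
    K.val (algebraMap Plane FunField f) = K.polyVal f :=
  Valuation.extendToLocalization_apply_map_apply (Γ := Multiplicative (WithTop ℤ)ᵒᵈ)
    (AddValuation.toValuation K.polyVal) (S := nonZeroDivisors Plane)
    (fun _ hf h => K.polyVal_ne_top (nonZeroDivisors.ne_zero hf) h) FunField f

theorem Cluster.val_unit (K : Cluster) {s : Plane} (hs : s ∈ originIdeal.primeCompl) :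
    K.val (algebraMap Plane FunField s) = 0 := by
  rw [K.val_algebraMap, Cluster.polyVal_apply]
  have : ¬ (X 0 : Plane) ∣ pullback (K.points ++ [.slope 0]) s := by
    rintro ⟨g, hg⟩
    apply hs
    have := constantCoeff_pullback (K.points ++ [.slope 0]) s
    rw [hg] at this
    simpa [originIdeal, RingHom.mem_ker] using this.symm
  rw [emultiplicity_eq_zero.2 this, map_zero]

theorem Cluster.val_nonneg (K : Cluster) (f : localRing) : 0 ≤ K.val (f : FunField) := by
  obtain ⟨a, s, hs, h⟩ := f.2
  have hs0 : algebraMap Plane FunField s ≠ 0 := fun h0 =>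
    hs (by
      have : s = 0 := IsFractionRing.injective Plane FunField (by simpa using h0)
      simp [this])
  have h1 : (f : FunField) * algebraMap Plane FunField s = algebraMap Plane FunField a := by
    rw [h, mul_assoc, inv_mul_cancel₀ hs0, mul_one]
  have h2 := congrArg K.val h1
  rw [AddValuation.map_mul, K.val_unit hs, add_zero] at h2
  rw [h2, K.val_algebraMap, Cluster.polyVal_apply]
  exact enatToInt_nonneg _

/-- The value of a nonzero function, as a real number. -/
def Cluster.realVal (K : Cluster) (f : FunField) : ℝ := ((K.val f).untopD 0 : ℤ)

/-! ### Curvettes and the last maximal contact value -/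

/-- The point `q` of the last exceptional curve `Eₙ` is a general (that is, free) point: it does
not lie on the strict transform of `Eⱼ` for any `1 ≤ j < n`. In the chart centred at `pⱼ₊₁`
the curve `Eⱼ` is `x = 0`, and the remaining blow-ups have centres `pⱼ₊₁, …, pₙ`. -/
def Cluster.IsFree (K : Cluster) (q : ExcPoint) : Prop :=
  ∀ j, 1 ≤ j → j ≤ K.points.length →
    constantCoeff (strictTransform (K.points.drop j ++ [q]) (X 0)) ≠ 0

/-- `φ ∈ R` is a curvette of the last exceptional curve `Eₙ`: it is analytically irreducible, and
the strict transform on the last surface of the germ `φ = 0` is non-singular and meets `Eₙ`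
transversally at a general point `q`. Here `φ = a / s` with `s(p) ≠ 0`, so `a = 0` is the same
germ as `φ = 0`; its strict transform near `q`, in the coordinates `(x, y)` centred at `q`, has
a nonzero linear form which is not a multiple of `x`, the equation of `Eₙ`. -/
def Cluster.IsCurvette (K : Cluster) (φ : localRing) : Prop :=
  ∃ a s : Plane, constantCoeff s ≠ 0 ∧
    (φ : FunField) * algebraMap Plane FunField s = algebraMap Plane FunField a ∧
    Irreducible (a : MvPowerSeries (Fin 2) ℂ) ∧
    ∃ q : ExcPoint, K.IsFree q ∧
      constantCoeff (strictTransform (K.points ++ [q]) a) = 0 ∧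
      coeff (Finsupp.single 1 1) (strictTransform (K.points ++ [q]) a) ≠ 0

/-- The last maximal contact value `β̄_{g+1}(ν) = ν(φₙ)`, where `φₙ` is a curvette of the divisor
`Eₙ` defining `ν`. All these curvettes have the same value, so the infimum is that value. -/
def Cluster.betaBar (K : Cluster) : ℝ :=
  sInf {b : ℝ | ∃ φ : localRing, K.IsCurvette φ ∧ b = K.realVal φ}

/-! ### Volume, the invariant `μ̂`, minimal valuations -/

/-- The valuation ideal `P_α = {f ∈ R | ν(f) ≥ α} ∪ {0}`. -/
def Cluster.valIdeal (K : Cluster) (α : ℕ) : Ideal localRing where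
  carrier := {f | ((α : ℤ) : WithTop ℤ) ≤ K.val (f : FunField)}
  zero_mem' := by simp
  add_mem' {a b} ha hb := (le_min ha hb).trans (K.val.map_add a b)
  smul_mem' c f hf := by
    have h : ((α : ℤ) : WithTop ℤ) ≤ K.val (f : FunField) := hf
    change ((α : ℤ) : WithTop ℤ) ≤ K.val ((c : FunField) * (f : FunField))
    rw [AddValuation.map_mul]
    simpa using add_le_add (K.val_nonneg c) h

/-- The ratios `dim_ℂ (R / P_α) / (α² / 2)`. -/
def Cluster.volRatio (K : Cluster) (α : ℕ) : ℝ :=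
  (Module.finrank ℂ (localRing ⧸ K.valIdeal α) : ℝ) / ((α : ℝ) ^ 2 / 2)

/-- The volume of the valuation: `vol(ν) = lim_{α → ∞} dim_ℂ (R / P_α) / (α² / 2)`. -/
def Cluster.vol (K : Cluster) : ℝ := limUnder atTop K.volRatio

/-- The value `ν(f)` of a polynomial `f ≠ 0`, as a real number. -/
def Cluster.valPoly (K : Cluster) (f : Plane) : ℝ := K.realVal (algebraMap Plane FunField f)

/-- `μ_d(ν) = max {ν(f) | f ∈ ℂ[u, v] nonzero, deg f ≤ d}`. -/
def Cluster.mu (K : Cluster) (d : ℕ) : ℝ :=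
  sSup {m : ℝ | ∃ f : Plane, f ≠ 0 ∧ f.totalDegree ≤ d ∧ m = K.valPoly f}

/-- `μ̂(ν) = lim_{d → ∞} μ_d(ν) / d`. -/
def Cluster.muHat (K : Cluster) : ℝ := limUnder atTop fun d : ℕ => K.mu d / d

/-- The valuation is minimal if `μ̂(ν) = √(1 / vol(ν))`. -/
def Cluster.IsMinimal (K : Cluster) : Prop := K.muHat = √(1 / K.vol)

end PlaneVal

end

noncomputable section

namespace PlaneVal


/-! ### Branches of irreducible power series in two variables -/

section Branch

variable {k : Type*} [Field k]

/-! Write β for the last maximal contact value. Everything follows from one asymptotic formula: the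
colength of the ideal of functions of value at least n is n²/(2β) + O(n)
(`Cluster.colength_growth`).

To prove the formula, pass to the completion ℂ⟦u,v⟧, with valuation ideals P_n, and take an
irreducible germ b of value N whose strict transform is smooth and transversal to the last
exceptional curve at a general point. Multiplication by b embeds ℂ⟦u,v⟧/P_{n-N} into ℂ⟦u,v⟧/P_n, and
the cokernel is seen on the branch b = 0, parametrized by x. It has dimension n + O(1): at most that
by Weierstrass division by b, at least that because some two functions on the plane have consecutive
orders on the branch, so that all large orders occur (`exists_colength_sub_bound`). Summing this
recursion gives n²/(2N) + O(n). The limit of the volume ratios is therefore 1/N; as it does not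
depend on b, neither does N, so N = β and vol = 1/β.

Next comes a Bézout inequality (`Cluster.ord_mul_ord_le`): coprime f and g satisfy ν(f)ν(g) ≤ β deg
f deg g. The ideal (f, g) has codimension at most deg f deg g in each large degree, so the colength
at ν(f) + ν(g) exceeds the sum of the colengths at ν(f) and ν(g) by at most deg f deg g. Applied to
fⁿ and gⁿ, the terms of order n² give the claim.

Finally, μ̂ bounds every quotient ν(f)/deg f, and μ̂ ≥ √β by comparing the dimension of the
polynomials of degree at most d, about d²/2, with the colength. If an irreducible f has ν(f)/deg f >
√β, the Bézout inequality forces ν(h)/deg h < √β for every other irreducible h. Values and degrees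
are additive on products, so f realizes μ̂ and is unique. If no irreducible polynomial exceeds √β,
then no polynomial does, and μ̂ = √β, which is minimality. -/

instance isAdicComplete_maximalIdeal_powerSeries :
    IsAdicComplete (IsLocalRing.maximalIdeal (PowerSeries k)) (PowerSeries k) := by
  rw [PowerSeries.maximalIdeal_eq_span_X]
  infer_instance

/-- Expressing the independent family through the spanning one gives a coefficient matrix without
kernel. The action through `φ` is written out because R and T will both be k⟦t⟧, with `φ` a
substitution. -/
theorem card_le_of_ringHom_spans {R T : Type*} [CommRing R] [Nontrivial R] [CommRing T]
    (φ : R →+* T) {m M : ℕ} (g : Fin M → T) (hg : ∀ h, ∃ c : Fin M → R, h = ∑ j, φ (c j) * g j)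
    (v : Fin m → T) (hv : ∀ c : Fin m → R, ∑ j, φ (c j) * v j = 0 → c = 0) : m ≤ M := by
  choose B hB using fun j => hg (v j)
  have hinj : Function.Injective (Matrix.vecMulLinear (R := R) (Matrix.of B)) := by
    rw [injective_iff_map_eq_zero]
    intro c hc
    apply hv
    have h1 : ∀ j, ∑ i, c i * B i j = 0 := fun j => by
      have := congrFun hc j
      simpa [Matrix.vecMulLinear, Matrix.vecMul, dotProduct] using this
    calc ∑ i, φ (c i) * v i = ∑ i, ∑ j, φ (c i) * (φ (B i j) * g j) := by
          refine Finset.sum_congr rfl fun i _ => ?_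
          rw [hB i, Finset.mul_sum]
      _ = ∑ j, φ (∑ i, c i * B i j) * g j := by
          rw [Finset.sum_comm]
          refine Finset.sum_congr rfl fun j _ => ?_
          rw [map_sum, Finset.sum_mul]
          refine Finset.sum_congr rfl fun i _ => ?_
          rw [map_mul, mul_assoc]
      _ = 0 := by simp [h1]
  simpa using card_le_of_injective R _ hinj

theorem coe_trunc_eq_sum (n : ℕ) (c : PowerSeries k) :
    ((PowerSeries.trunc n c : Polynomial k) : PowerSeries k) =
      ∑ j : Fin n, PowerSeries.coeff j c • (PowerSeries.X : PowerSeries k) ^ (j : ℕ) := by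
  rw [Fin.sum_univ_eq_sum_range
    (fun j => PowerSeries.coeff j c • (PowerSeries.X : PowerSeries k) ^ j)]
  ext m
  rw [map_sum, Polynomial.coeff_coe, PowerSeries.coeff_trunc]
  simp [PowerSeries.coeff_X_pow]

/-- This is expansion in base `φ X`: split off the part of degree below M, divide the rest by `φ X`,
and repeat. -/
theorem exists_sum_mul_X_pow {φ : PowerSeries k →ₐ[k] PowerSeries k} {M : ℕ} (hM : 1 ≤ M)
    {w : PowerSeries k} (hw : IsUnit w) (hφ : φ PowerSeries.X = PowerSeries.X ^ M * w)
    (h : PowerSeries k) :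
    ∃ c : Fin M → PowerSeries k, h = ∑ j, φ (c j) * PowerSeries.X ^ (j : ℕ) := by
  obtain ⟨w', hw'⟩ := hw.exists_right_inv
  have step : ∀ h : PowerSeries k, ∃ (d : Fin M → k) (h' : PowerSeries k),
      h = ∑ j, PowerSeries.C (d j) * PowerSeries.X ^ (j : ℕ) + φ PowerSeries.X * h' := by
    intro h
    refine ⟨fun j => PowerSeries.coeff j h,
      w' * PowerSeries.mk fun i => PowerSeries.coeff (i + M) h, ?_⟩
    have e := PowerSeries.eq_X_pow_mul_shift_add_trunc M h
    have e2 := coe_trunc_eq_sum M h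
    simp only [PowerSeries.smul_eq_C_mul] at e2
    rw [← e2, hφ, add_comm]
    nth_rw 1 [e]
    congr 1
    rw [show (PowerSeries.X : PowerSeries k) ^ M * w * (w' * PowerSeries.mk fun i =>
      PowerSeries.coeff (i + M) h) = (w * w') * (PowerSeries.X ^ M * PowerSeries.mk fun i =>
      PowerSeries.coeff (i + M) h) by ring, hw', one_mul]
  choose D S hDS using step
  -- The n-th quotient; its digits are the coefficients of X ^ n in the series `c j`.
  let hs : ℕ → PowerSeries k := fun n => S^[n] h
  refine ⟨fun j => PowerSeries.mk fun n => D (hs n) j, ?_⟩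
  have key : ∀ n, ∃ r, h = ∑ j : Fin M, φ ((PowerSeries.trunc n (PowerSeries.mk fun n => D (hs n) j) :
      Polynomial k) : PowerSeries k) * PowerSeries.X ^ (j : ℕ) + φ PowerSeries.X ^ n * r ∧ r = hs n := by
    intro n
    refine ⟨hs n, ?_, rfl⟩
    induction n with
    | zero => simp [hs]
    | succ n ih =>
      nth_rw 1 [ih]
      rw [hDS (hs n)]
      simp only [PowerSeries.trunc_succ, PowerSeries.coeff_mk, Polynomial.coe_add, map_add, add_mul,
        Finset.sum_add_distrib]
      rw [add_assoc]
      congr 1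
      rw [mul_add, Finset.mul_sum, pow_succ, mul_assoc (φ PowerSeries.X ^ n)]
      have e3 : S (hs n) = hs (n + 1) := by simp only [hs, Function.iterate_succ_apply']
      rw [e3]
      congr 1
      refine Finset.sum_congr rfl fun j _ => ?_
      rw [Polynomial.coe_monomial, PowerSeries.monomial_eq_C_mul_X_pow, map_mul, map_pow,
        show PowerSeries.C (D (hs n) j) = algebraMap k (PowerSeries k) (D (hs n) j) from rfl,
        AlgHom.commutes]
      ring
  rw [← sub_eq_zero]
  ext n
  rw [map_zero]
  -- No continuity of `φ` is needed: the tail of a series beyond degree n is a multiple of X ^ (n +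
  -- 1), and `φ` sends it to a multiple of (φ X) ^ (n + 1), hence of X ^ (n + 1).
  have hdvd : (PowerSeries.X : PowerSeries k) ^ (n + 1) ∣ h - ∑ j : Fin M,
      φ (PowerSeries.mk fun n => D (hs n) j) * PowerSeries.X ^ (j : ℕ) := by
    obtain ⟨r, hr, -⟩ := key (n + 1)
    have hX : (PowerSeries.X : PowerSeries k) ^ (n + 1) ∣ φ PowerSeries.X ^ (n + 1) := by
      apply pow_dvd_pow_of_dvd
      rw [hφ]
      exact (dvd_pow_self _ (by omega)).mul_right _
    nth_rw 1 [hr]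
    rw [add_sub_right_comm, ← Finset.sum_sub_distrib]
    refine dvd_add (Finset.dvd_sum fun j _ => ?_) (hX.mul_right _)
    rw [← sub_mul, ← map_sub]
    refine Dvd.dvd.mul_right (hX.trans ?_) _
    rw [← map_pow]
    apply map_dvd
    rw [PowerSeries.X_pow_dvd_iff]
    intro i hi
    simp [PowerSeries.coeff_trunc, hi]
  exact PowerSeries.X_pow_dvd_iff.1 hdvd n (Nat.lt_succ_self n)

/-- A monic factor of a distinguished polynomial reduces to a power of X modulo the maximal ideal.
If it is a unit as a power series, its constant term survives, so that power is X ^ 0 and the factor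
is 1. -/
theorem irreducible_of_isDistinguishedAt {f : Polynomial (PowerSeries k)}
    (hf : f.IsDistinguishedAt (IsLocalRing.maximalIdeal (PowerSeries k)))
    (hirr : Irreducible (f : PowerSeries (PowerSeries k))) : Irreducible f := by
  have hne : f ≠ 1 := by
    rintro rfl
    exact hirr.not_isUnit (by simp)
  have haux : ∀ p q : Polynomial (PowerSeries k), p.Monic → p * q = f →
      IsUnit (p : PowerSeries (PowerSeries k)) → p = 1 := by
    intro p q hp hpq hu
    have h1 : p.map (Ideal.Quotient.mk (IsLocalRing.maximalIdeal (PowerSeries k))) ∣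
        Polynomial.X ^ f.natDegree := by
      rw [← hf.map_eq_X_pow, ← hpq, Polynomial.map_mul]
      exact dvd_mul_right _ _
    let _ : Field (PowerSeries k ⧸ IsLocalRing.maximalIdeal (PowerSeries k)) :=
      Ideal.Quotient.field _
    obtain ⟨i, -, hi⟩ := (dvd_prime_pow Polynomial.prime_X _).1 h1
    have h3 : p.map (Ideal.Quotient.mk (IsLocalRing.maximalIdeal (PowerSeries k))) =
        Polynomial.X ^ i :=
      Polynomial.eq_of_monic_of_associated (hp.map _) (Polynomial.monic_X_pow i) hi
    rw [PowerSeries.isUnit_iff_constantCoeff, Polynomial.constantCoeff_coe] at hu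
    have h4 : (p.map (Ideal.Quotient.mk (IsLocalRing.maximalIdeal (PowerSeries k)))).coeff 0 ≠ 0 := by
      rw [Polynomial.coeff_map]
      exact (hu.map _).ne_zero
    rw [h3, Polynomial.coeff_X_pow] at h4
    have h5 : i = 0 := by
      by_contra h
      exact h4 (if_neg (Ne.symm h))
    have h6 := hp.natDegree_map (Ideal.Quotient.mk (IsLocalRing.maximalIdeal (PowerSeries k)))
    rw [h3, h5, pow_zero, Polynomial.natDegree_one] at h6
    exact Polynomial.eq_one_of_monic_natDegree_zero hp h6.symm
  rw [hf.monic.irreducible_iff_natDegree' ]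
  refine ⟨hne, fun p q hp hq hpq hmem => ?_⟩
  have hcoe : (f : PowerSeries (PowerSeries k)) = p * q := by rw [← hpq, Polynomial.coe_mul]
  rw [Finset.mem_Ioc] at hmem
  rcases hirr.isUnit_or_isUnit hcoe with h | h
  · have h1 := haux p q hp hpq h
    rw [h1, one_mul] at hpq
    rw [hpq] at hmem
    omega
  · have := haux q p hq (by rw [mul_comm, hpq]) h
    rw [this] at hmem
    simp at hmem

theorem map_C_ne_zero {ε : PowerSeries (PowerSeries k) →+* PowerSeries k}
    (hX : ε (PowerSeries.C PowerSeries.X) ≠ 0) {d : PowerSeries k} (hd : d ≠ 0) :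
    ε (PowerSeries.C d) ≠ 0 := by
  obtain ⟨n, u, rfl⟩ := IsDiscreteValuationRing.eq_unit_mul_pow_irreducible hd
    (PowerSeries.X_irreducible (R := k))
  rw [map_mul, map_mul, map_pow, map_pow]
  exact mul_ne_zero ((u.isUnit.map _).map _).ne_zero (pow_ne_zero _ hX)

/-- A branch whose coordinate `u` has order `M` is given by an equation of degree at most `M`
in the other coordinate. -/
theorem natDegree_le_of_branch {ε : PowerSeries (PowerSeries k) →ₐ[k] PowerSeries k} {M : ℕ}
    (hM : 1 ≤ M) {w : PowerSeries k} (hw : IsUnit w)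
    (hε : ε (PowerSeries.C PowerSeries.X) = PowerSeries.X ^ M * w)
    {f : Polynomial (PowerSeries k)}
    (hf : f.IsDistinguishedAt (IsLocalRing.maximalIdeal (PowerSeries k)))
    (hirr : Irreducible f) (h0 : ε f = 0) : f.natDegree ≤ M := by
  have hX : ε (PowerSeries.C PowerSeries.X) ≠ 0 := by
    rw [hε]
    exact mul_ne_zero (pow_ne_zero _ PowerSeries.X_ne_zero) hw.ne_zero
  obtain ⟨φ, hφ⟩ : ∃ φ : PowerSeries k →ₐ[k] PowerSeries k, ∀ c, φ c = ε (PowerSeries.C c) :=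
    ⟨{ (ε : PowerSeries (PowerSeries k) →+* PowerSeries k).comp PowerSeries.C with
        commutes' := fun r => by
          have h1 := ε.commutes r
          rw [PowerSeries.algebraMap_apply] at h1
          exact h1 }, fun _ => rfl⟩
  -- The target is generated over k⟦u⟧ by M powers of the parameter, so it suffices that the powers
  -- of `ε X` below deg f are independent over k⟦u⟧.
  refine card_le_of_ringHom_spans (φ : PowerSeries k →+* PowerSeries k)
    (fun j : Fin M => PowerSeries.X ^ (j : ℕ)) (fun h => exists_sum_mul_X_pow hM hw ((hφ _).trans hε) h)
    (fun j : Fin f.natDegree => ε PowerSeries.X ^ (j : ℕ)) fun c hc => ?_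
  let p : Polynomial (PowerSeries k) := ∑ j : Fin f.natDegree, Polynomial.C (c j) * Polynomial.X ^ (j : ℕ)
  have hpc : ∀ j : Fin f.natDegree, p.coeff j = c j := by
    intro j
    simp only [p, Polynomial.finsetSum_coeff, Polynomial.coeff_C_mul_X_pow]
    rw [Finset.sum_eq_single j]
    · simp
    · intro b _ hb
      rw [if_neg]
      exact fun h => hb (Fin.ext h.symm)
    · simp
  have hpε : ε p = 0 := by
    rw [← hc]
    simp only [p, ← Polynomial.coeToPowerSeries.ringHom_apply, map_sum, map_mul, map_pow]
    simp [hφ]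
  have hdeg : p.degree < f.natDegree := by
    refine lt_of_le_of_lt (Polynomial.degree_sum_le _ _) ?_
    rw [Finset.sup_lt_iff (WithBot.bot_lt_coe _)]
    intro j _
    exact lt_of_le_of_lt (Polynomial.degree_C_mul_X_pow_le _ _) (by exact_mod_cast j.2)
  suffices hp0 : p = 0 by
    funext j
    rw [← hpc, hp0]
    simp
  by_contra hp
  let K := FractionRing (PowerSeries k)
  have hinj : Function.Injective (algebraMap (PowerSeries k) K) := IsFractionRing.injective _ _
  have hirrK : Irreducible (f.map (algebraMap (PowerSeries k) K)) :=
    (hf.monic.irreducible_iff_irreducible_map_fraction_map).1 hirr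
  have hcop : IsCoprime (f.map (algebraMap (PowerSeries k) K)) (p.map (algebraMap (PowerSeries k) K)) := by
    rw [hirrK.coprime_iff_not_dvd]
    intro hd
    have h1 := Polynomial.degree_le_of_dvd hd (by rwa [Ne, Polynomial.map_eq_zero_iff hinj])
    rw [Polynomial.degree_map_eq_of_injective hinj, Polynomial.degree_map_eq_of_injective hinj,
      Polynomial.degree_eq_natDegree hf.monic.ne_zero] at h1
    exact absurd hdeg (not_lt.2 h1)
  have hres : Polynomial.resultant f p ≠ 0 := by
    have h1 := Polynomial.resultant_ne_zero _ _ hcop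
    rw [Polynomial.natDegree_map_eq_of_injective hinj, Polynomial.natDegree_map_eq_of_injective hinj,
      Polynomial.resultant_map_map] at h1
    exact fun h => h1 (by rw [h, map_zero])
  have hfd : f.natDegree ≠ 0 := by
    intro h
    exact hirr.not_isUnit (by rw [Polynomial.eq_one_of_monic_natDegree_zero hf.monic h]; exact isUnit_one)
  obtain ⟨a, b, -, -, hab⟩ := Polynomial.exists_mul_add_mul_eq_C_resultant f p le_rfl le_rfl (Or.inl hfd)
  apply map_C_ne_zero (ε := (ε : PowerSeries (PowerSeries k) →+* PowerSeries k)) hX hres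
  have := congrArg (fun q : Polynomial (PowerSeries k) => ε (q : PowerSeries (PowerSeries k))) hab
  simp only [Polynomial.coe_add, Polynomial.coe_mul, map_add, map_mul, h0, hpε, zero_mul, add_zero,
    Polynomial.coe_C] at this
  exact this.symm

/-- The quotient of `k⟦u⟧⟦v⟧` by an irreducible `a`, vanishing on a branch along which `u` has
order `M`, and by `u ^ n` is spanned by `n * M` elements. -/
theorem exists_spanning_of_branch {ε : PowerSeries (PowerSeries k) →ₐ[k] PowerSeries k} {M : ℕ}
    (hM : 1 ≤ M) {w : PowerSeries k} (hw : IsUnit w)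
    (hε : ε (PowerSeries.C PowerSeries.X) = PowerSeries.X ^ M * w)
    {a : PowerSeries (PowerSeries k)} (hirr : Irreducible a) (h0 : ε a = 0) (n : ℕ) :
    ∃ g : Fin n × Fin M → PowerSeries (PowerSeries k), ∀ f, ∃ (c : Fin n × Fin M → k)
      (q r : PowerSeries (PowerSeries k)),
      f = ∑ i, c i • g i + a * q + PowerSeries.C PowerSeries.X ^ n * r := by
  have hX : ε (PowerSeries.C PowerSeries.X) ≠ 0 := by
    rw [hε]
    exact mul_ne_zero (pow_ne_zero _ PowerSeries.X_ne_zero) hw.ne_zero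
  -- Weierstrass preparation requires that u does not divide a. Otherwise a is u times a unit, which
  -- does not vanish on the branch.
  have hres : a.map (IsLocalRing.residue (PowerSeries k)) ≠ 0 := by
    intro h
    have hdvd : PowerSeries.C PowerSeries.X ∣ a := by
      have h1 : ∀ i, ∃ b, PowerSeries.coeff i a = PowerSeries.X * b := by
        intro i
        have := congrArg (PowerSeries.coeff i) h
        rw [PowerSeries.coeff_map, map_zero, IsLocalRing.residue_eq_zero_iff,
          PowerSeries.maximalIdeal_eq_span_X, Ideal.mem_span_singleton] at this
        exact this
      choose b hb using h1
      refine ⟨PowerSeries.mk b, ?_⟩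
      ext1 i
      rw [PowerSeries.coeff_C_mul, PowerSeries.coeff_mk, hb]
    obtain ⟨b, rfl⟩ := hdvd
    rcases hirr.isUnit_or_isUnit rfl with hu | hu
    · rw [PowerSeries.isUnit_iff_constantCoeff, PowerSeries.constantCoeff_C] at hu
      exact PowerSeries.X_irreducible.not_isUnit hu
    · rw [map_mul] at h0
      exact mul_ne_zero hX (hu.map ε).ne_zero h0
  obtain ⟨f, h, hW⟩ := a.exists_isWeierstrassFactorization hres
  have hass : Associated a (f : PowerSeries (PowerSeries k)) := by
    obtain ⟨u, hu⟩ := hW.isUnit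
    refine Associated.symm ⟨u, ?_⟩
    rw [hu, ← hW.eq_mul]
  have hf0 : ε f = 0 := by
    have h1 := h0
    rw [hW.eq_mul, map_mul] at h1
    exact (mul_eq_zero.1 h1).resolve_right (hW.isUnit.map ε).ne_zero
  have hdeg : f.natDegree ≤ M := natDegree_le_of_branch hM hw hε hW.isDistinguishedAt
    (irreducible_of_isDistinguishedAt hW.isDistinguishedAt (hass.irreducible hirr)) hf0
  -- The spanning elements are u^i v^j with i < n, j < M: division by a leaves degree below M in v,
  -- and the coefficients are then truncated at u^n.
  refine ⟨fun i => PowerSeries.C (PowerSeries.X ^ (i.1 : ℕ)) * PowerSeries.X ^ (i.2 : ℕ), fun F => ?_⟩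
  obtain ⟨q, r, hqr⟩ := F.exists_isWeierstrassDivision hres
  have hrdeg : r.natDegree < M ∨ r = 0 := by
    by_cases hr : r = 0
    · exact Or.inr hr
    left
    have h1 := hqr.degree_lt
    have h2 := hW.natDegree_eq_toNat_order_map
    rw [Polynomial.degree_eq_natDegree hr] at h1
    have h3 : r.natDegree < (a.map (IsLocalRing.residue (PowerSeries k))).order.toNat := by
      exact_mod_cast h1
    omega
  have hr : r = ∑ j : Fin M, Polynomial.C (r.coeff j) * Polynomial.X ^ (j : ℕ) := by
    rw [Fin.sum_univ_eq_sum_range (fun j => Polynomial.C (r.coeff j) * Polynomial.X ^ j)]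
    rcases hrdeg with hrd | hrd
    · exact r.as_sum_range_C_mul_X_pow' hrd
    · simp [hrd]
  have hr' : (r : PowerSeries (PowerSeries k)) =
      ∑ j : Fin M, PowerSeries.C (r.coeff j) * PowerSeries.X ^ (j : ℕ) := by
    nth_rw 1 [hr]
    rw [← Polynomial.coeToPowerSeries.ringHom_apply, map_sum]
    simp
  have hc : ∀ c : PowerSeries k, c = ∑ i : Fin n, PowerSeries.coeff i c • (PowerSeries.X : PowerSeries k) ^ (i : ℕ) +
      PowerSeries.X ^ n * PowerSeries.mk fun i => PowerSeries.coeff (i + n) c := by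
    intro c
    nth_rw 1 [c.eq_X_pow_mul_shift_add_trunc n]
    rw [add_comm]
    congr 1
    exact coe_trunc_eq_sum n c
  refine ⟨fun i => PowerSeries.coeff i.1 (r.coeff i.2), q,
    ∑ j : Fin M, PowerSeries.C (PowerSeries.mk fun i => PowerSeries.coeff (i + n) (r.coeff j)) * PowerSeries.X ^ (j : ℕ), ?_⟩
  nth_rw 1 [hqr.eq_mul_add]
  rw [add_comm, add_right_comm]
  congr 1
  rw [hr', Fintype.sum_prod_type_right, Finset.mul_sum, ← Finset.sum_add_distrib]
  refine Finset.sum_congr rfl fun j _ => ?_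
  nth_rw 1 [hc (r.coeff j)]
  rw [map_add, map_sum, add_mul, Finset.sum_mul, map_mul, map_pow, mul_assoc]
  congr 1
  refine Finset.sum_congr rfl fun i _ => ?_
  rw [← smul_mul_assoc]
  congr 1
  ext1 m
  rw [PowerSeries.coeff_C, PowerSeries.coeff_smul, PowerSeries.coeff_C]
  split_ifs <;> simp

end Branch


/-! ### The completed local ring and the order along `x = 0` -/

/-- The completion `ℂ⟦u, v⟧` of the local ring of the plane at a point. -/
abbrev Germ : Type := MvPowerSeries (Fin 2) ℂ

/-- The order of vanishing along `x = 0`. -/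
def xord (f : Germ) : ℕ∞ := f.weightedOrder (Pi.single 0 1)

theorem weight_single_zero (d : Fin 2 →₀ ℕ) :
    Finsupp.weight (Pi.single 0 1 : Fin 2 → ℕ) d = d 0 := by
  rw [Finsupp.weight_apply, Finsupp.sum_fintype _ _ (by simp)]
  simp

theorem X_pow_dvd_iff_le_xord {n : ℕ} {f : Germ} :
    (MvPowerSeries.X 0 : Germ) ^ n ∣ f ↔ (n : ℕ∞) ≤ xord f := by
  rw [MvPowerSeries.X_pow_dvd_iff]
  constructor
  · intro h
    exact MvPowerSeries.nat_le_weightedOrder _ fun d hd => h d (by rwa [weight_single_zero] at hd)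
  · intro h d hd
    refine MvPowerSeries.coeff_eq_zero_of_lt_weightedOrder _ (lt_of_lt_of_le ?_ h)
    rw [weight_single_zero]
    exact_mod_cast hd

theorem xord_mul (f g : Germ) : xord (f * g) = xord f + xord g :=
  MvPowerSeries.weightedOrder_mul _ f g

theorem xord_eq_zero_iff {f : Germ} : xord f = 0 ↔ ¬ MvPowerSeries.X 0 ∣ f := by
  rw [← pow_one (MvPowerSeries.X 0 : Germ), X_pow_dvd_iff_le_xord, Nat.cast_one,
    Order.one_le_iff_ne_zero, not_not]

theorem xord_of_isUnit {f : Germ} (hf : IsUnit f) : xord f = 0 := by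
  rw [xord_eq_zero_iff]
  intro h
  have := isUnit_of_dvd_unit h hf
  rw [MvPowerSeries.isUnit_iff_constantCoeff] at this
  simp at this

theorem xord_X : xord (MvPowerSeries.X 0) = 1 := by
  refine le_antisymm ?_ ?_
  · have := MvPowerSeries.weightedOrder_le (Pi.single 0 1 : Fin 2 → ℕ)
      (f := (MvPowerSeries.X 0 : Germ)) (d := Finsupp.single 0 1) (by simp)
    rw [weight_single_zero] at this
    simpa [xord] using this
  · have := (X_pow_dvd_iff_le_xord (n := 1) (f := MvPowerSeries.X 0)).1 (by simp)
    simpa using this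

theorem xord_X_pow (n : ℕ) : xord (MvPowerSeries.X 0 ^ n) = n := by
  induction n with
  | zero => simpa using xord_of_isUnit isUnit_one
  | succ n ih => rw [pow_succ, xord_mul, ih, xord_X]; simp

theorem exists_eq_X_pow_mul {f : Germ} (hf : f ≠ 0) :
    ∃ (n : ℕ) (g : Germ), f = MvPowerSeries.X 0 ^ n * g ∧ ¬ MvPowerSeries.X 0 ∣ g := by
  have hfin : xord f ≠ ⊤ := by
    rwa [xord, Ne, MvPowerSeries.weightedOrder_eq_top_iff]
  obtain ⟨n, hn⟩ := ENat.ne_top_iff_exists.1 hfin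
  obtain ⟨g, hg⟩ := X_pow_dvd_iff_le_xord.2 hn.le
  refine ⟨n, g, hg, ?_⟩
  rw [← xord_eq_zero_iff]
  rw [hg, xord_mul, xord_X_pow] at hn
  generalize xord g = m at hn
  cases m with
  | top => simp at hn
  | coe m => norm_cast at hn ⊢; omega

theorem X_pow_dvd_mul_iff {a b g : Germ} {n N : ℕ} (ha : a = MvPowerSeries.X 0 ^ N * b)
    (hb : ¬ MvPowerSeries.X 0 ∣ b) :
    MvPowerSeries.X 0 ^ n ∣ a * g ↔ MvPowerSeries.X 0 ^ (n - N) ∣ g := by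
  rw [X_pow_dvd_iff_le_xord, X_pow_dvd_iff_le_xord, ha, xord_mul, xord_mul, xord_X_pow,
    xord_eq_zero_iff.2 hb, add_zero, ENat.natCast_sub, tsub_le_iff_left]

theorem coe_X_pow_dvd_iff {f : Plane} {n : ℕ} :
    (MvPowerSeries.X 0 : Germ) ^ n ∣ (f : Germ) ↔ (X 0 : Plane) ^ n ∣ f := by
  constructor
  · intro h
    rw [MvPowerSeries.X_pow_dvd_iff] at h
    rw [X_pow_eq_monomial, monomial_one_dvd_iff_modMonomial_eq_zero]
    ext d
    by_cases hd : Finsupp.single 0 n ≤ d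
    · rw [coeff_modMonomial_of_le _ hd, coeff_zero]
    · rw [coeff_modMonomial_of_not_le _ hd, coeff_zero, ← MvPolynomial.coeff_coe]
      apply h
      rw [Finsupp.single_le_iff] at hd
      omega
  · rintro ⟨g, rfl⟩
    exact ⟨g, by simp⟩

theorem not_X_dvd_of_coeff {b : Germ} (h : MvPowerSeries.coeff (Finsupp.single 1 1) b ≠ 0) :
    ¬ MvPowerSeries.X 0 ∣ b := fun hd =>
  h (MvPowerSeries.X_dvd_iff.1 hd _ (by simp))

/-! ### The blow-up of power series -/

theorem hasSubst_chart (t : ExcPoint) :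
    MvPowerSeries.HasSubst (fun i => ((chart t (X i) : Plane) : Germ)) := by
  apply MvPowerSeries.hasSubst_of_constantCoeff_zero
  intro i
  have := constantCoeff_chart t (X i)
  rw [constantCoeff_X] at this
  rw [← MvPowerSeries.coeff_zero_eq_constantCoeff_apply, MvPolynomial.coeff_coe]
  exact this

/-- The blow-up of the origin on power series. -/
def chartGerm (t : ExcPoint) : Germ →ₐ[ℂ] Germ := MvPowerSeries.substAlgHom (hasSubst_chart t)

theorem chartGerm_coe (t : ExcPoint) (f : Plane) : chartGerm t (f : Germ) = (chart t f : Plane) := by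
  rw [chartGerm, MvPowerSeries.substAlgHom_coe]
  have : (aeval fun i => ((chart t (X i) : Plane) : Germ) : Plane →ₐ[ℂ] Germ) =
      (coeToMvPowerSeries.algHom ℂ).comp (chart t) := by
    apply MvPolynomial.algHom_ext
    intro i
    rw [aeval_X]
    simp [coeToMvPowerSeries.algHom_apply]
  rw [this]
  simp [coeToMvPowerSeries.algHom_apply]

/-- The composition of blow-ups on power series. -/
def pullGerm : List ExcPoint → Germ →ₐ[ℂ] Germ
  | [] => AlgHom.id ℂ Germ
  | t :: ts => (pullGerm ts).comp (chartGerm t)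

theorem pullGerm_coe (l : List ExcPoint) (f : Plane) :
    pullGerm l (f : Germ) = (pullback l f : Plane) := by
  induction l generalizing f with
  | nil => rfl
  | cons t ts ih => exact (congrArg (pullGerm ts) (chartGerm_coe t f)).trans (ih _)

theorem X_dvd_chart_X (t : ExcPoint) (i : Fin 2) : (X 0 : Plane) ∣ chart t (X i) := by
  cases t <;> fin_cases i <;> simp [chart]

/-- Both coordinates pull back to multiples of x, so a monomial of degree at least n pulls back to a
multiple of x ^ n. -/
theorem X_pow_dvd_chartGerm (t : ExcPoint) {f : Germ} {n : ℕ}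
    (hf : ∀ d, Finsupp.degree d < n → MvPowerSeries.coeff d f = 0) :
    MvPowerSeries.X 0 ^ n ∣ chartGerm t f := by
  rw [X_pow_dvd_iff_le_xord, chartGerm, MvPowerSeries.substAlgHom_apply]
  refine le_trans ?_ (MvPowerSeries.le_weightedOrder_subst _ (hasSubst_chart t) f)
  refine le_iInf fun d => le_iInf fun hd => ?_
  have h1 : n ≤ Finsupp.degree d := not_lt.1 fun h => hd (hf d h)
  refine le_trans (Nat.cast_le.2 h1) ?_
  rw [Finsupp.weight_apply, Finsupp.sum, Finsupp.degree_apply, Nat.cast_sum]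
  refine Finset.sum_le_sum fun i _ => ?_
  have h2 : (1 : ℕ∞) ≤ xord ((chart t (X i) : Plane) : Germ) := by
    have := (X_pow_dvd_iff_le_xord (n := 1) (f := ((chart t (X i) : Plane) : Germ))).1
      (coe_X_pow_dvd_iff.2 (by simpa using X_dvd_chart_X t i))
    simpa using this
  calc ((d i : ℕ) : ℕ∞) = d i • (1 : ℕ∞) := by simp
    _ ≤ d i • xord ((chart t (X i) : Plane) : Germ) := nsmul_le_nsmul_right h2 _

theorem X_dvd_pullback_X (l : List ExcPoint) : (X 0 : Plane) ∣ pullback l (X 0) := by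
  induction l with
  | nil => exact dvd_rfl
  | cons t ts ih => exact ih.trans (map_dvd (pullback ts) (X_dvd_chart_X t 0))

/-- The n-th power of the maximal ideal lies in the n-th valuation ideal. This makes colengths
finite and lets polynomial truncations replace power series. -/
theorem X_pow_dvd_pullGerm {l : List ExcPoint} (hl : l ≠ []) {f : Germ} {n : ℕ}
    (hf : ∀ d, Finsupp.degree d < n → MvPowerSeries.coeff d f = 0) :
    MvPowerSeries.X 0 ^ n ∣ pullGerm l f := by
  obtain ⟨t, ts, rfl⟩ := List.exists_cons_of_ne_nil hl
  have h1 := map_dvd (pullGerm ts) (X_pow_dvd_chartGerm t hf)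
  rw [map_pow] at h1
  refine dvd_trans (pow_dvd_pow_of_dvd ?_ n) h1
  have h2 := pullGerm_coe ts (X 0)
  rw [MvPolynomial.coe_X] at h2
  rw [h2]
  have := coe_X_pow_dvd_iff (n := 1).2 (by simpa using X_dvd_pullback_X ts)
  simpa using this

/-! ### Strict transforms -/

theorem X_pow_dvd_iff_le_multiplicity {f : Plane} (hf : f ≠ 0) {n : ℕ} :
    (X 0 : Plane) ^ n ∣ f ↔ n ≤ multiplicity (X 0) f := by
  have hfin : FiniteMultiplicity (X 0 : Plane) f := FiniteMultiplicity.of_prime_left X_prime hf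
  exact hfin.pow_dvd_iff_le_multiplicity

theorem chart_eq_X_pow_mul_strictStep (t : ExcPoint) (f : Plane) :
    ∃ m : ℕ, chart t f = X 0 ^ m * strictStep t f := by
  refine ⟨multiplicity (X 0) (chart t f), ?_⟩
  by_cases hf : f = 0
  · simp [hf, strictStep]
  have h0 : chart t f ≠ 0 := (map_ne_zero_iff _ (chart_injective t)).2 hf
  obtain ⟨g, hg⟩ := (X_pow_dvd_iff_le_multiplicity h0).2 le_rfl
  have h1 := divMonomial_monomial_mul (Finsupp.single 0 (multiplicity (X 0) (chart t f))) g
  rw [← X_pow_eq_monomial, ← hg] at h1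
  rw [strictStep, h1]
  exact hg

theorem strictStep_ne_zero (t : ExcPoint) {f : Plane} (hf : f ≠ 0) : strictStep t f ≠ 0 := by
  intro h
  obtain ⟨m, hm⟩ := chart_eq_X_pow_mul_strictStep t f
  rw [h, mul_zero] at hm
  exact (map_ne_zero_iff _ (chart_injective t)).2 hf hm

theorem not_X_dvd_strictStep (t : ExcPoint) {f : Plane} (hf : f ≠ 0) :
    ¬ (X 0 : Plane) ∣ strictStep t f := by
  have h0 : chart t f ≠ 0 := (map_ne_zero_iff _ (chart_injective t)).2 hf
  obtain ⟨g, hg⟩ := (X_pow_dvd_iff_le_multiplicity h0).2 le_rfl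
  have h1 := divMonomial_monomial_mul (Finsupp.single 0 (multiplicity (X 0) (chart t f))) g
  rw [← X_pow_eq_monomial, ← hg] at h1
  have h2 : strictStep t f = g := h1
  rw [h2]
  rintro ⟨k, rfl⟩
  have h3 : (X 0 : Plane) ^ (multiplicity (X 0) (chart t f) + 1) ∣ chart t f :=
    ⟨k, by nth_rw 1 [hg]; ring⟩
  have := (X_pow_dvd_iff_le_multiplicity h0).1 h3
  omega

theorem strictTransform_ne_zero (l : List ExcPoint) {f : Plane} (hf : f ≠ 0) :
    strictTransform l f ≠ 0 := by
  induction l generalizing f with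
  | nil => exact hf
  | cons t ts ih => exact ih (strictStep_ne_zero t hf)

theorem strictTransform_append (l : List ExcPoint) (q : ExcPoint) (f : Plane) :
    strictTransform (l ++ [q]) f = strictStep q (strictTransform l f) := by
  induction l generalizing f with
  | nil => rfl
  | cons t ts ih => exact ih _

theorem not_X_dvd_strictTransform (l : List ExcPoint) (q : ExcPoint) {f : Plane} (hf : f ≠ 0) :
    ¬ (X 0 : Plane) ∣ strictTransform (l ++ [q]) f := by
  rw [strictTransform_append]
  exact not_X_dvd_strictStep q (strictTransform_ne_zero l hf)

/-- Products of the equations, in the last chart, of the exceptional curves. -/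
def excMonoid : List ExcPoint → Submonoid Plane
  | [] => ⊥
  | _ :: ts => Submonoid.closure {pullback ts (X 0)} ⊔ excMonoid ts

theorem pullback_X_mem_excMonoid (t : ExcPoint) (ts : List ExcPoint) :
    pullback ts (X 0) ∈ excMonoid (t :: ts) :=
  (le_sup_left : Submonoid.closure {pullback ts (X 0)} ≤ excMonoid (t :: ts))
    (Submonoid.subset_closure rfl)

theorem excMonoid_le_cons (t : ExcPoint) (ts : List ExcPoint) :
    excMonoid ts ≤ excMonoid (t :: ts) := le_sup_right

theorem pullback_eq_mul_strictTransform (l : List ExcPoint) (f : Plane) :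
    ∃ e ∈ excMonoid l, pullback l f = e * strictTransform l f := by
  induction l generalizing f with
  | nil => exact ⟨1, one_mem _, (one_mul _).symm⟩
  | cons t ts ih =>
    obtain ⟨m, hm⟩ := chart_eq_X_pow_mul_strictStep t f
    obtain ⟨e, he, h⟩ := ih (strictStep t f)
    refine ⟨pullback ts (X 0) ^ m * e, mul_mem (pow_mem (pullback_X_mem_excMonoid t ts) m)
      (excMonoid_le_cons t ts he), ?_⟩
    have h1 : pullback (t :: ts) f = pullback ts (chart t f) := rfl
    have h2 : strictTransform (t :: ts) f = strictTransform ts (strictStep t f) := rfl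
    rw [h1, h2, hm, map_mul, map_pow, h, mul_assoc]

theorem exists_chart_X_eq (t : ExcPoint) : ∃ i, chart t (X i) = X 0 := by
  cases t
  · exact ⟨0, by simp [chart]⟩
  · exact ⟨1, by simp [chart]⟩

/-- Both x and xy lie in the image of the chart, so inverting the blow-up only costs powers of x. -/
theorem exists_chart_eq_X_pow_mul (t : ExcPoint) (h : Plane) :
    ∃ (m : ℕ) (f : Plane), chart t f = X 0 ^ m * h := by
  have hX1 : ∃ g, chart t g = X 0 * X 1 := by
    cases t with
    | slope c => exact ⟨X 1 - C c * X 0, by simp [chart]; ring⟩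
    | vertical => exact ⟨X 0, by simp [chart]⟩
  obtain ⟨i, hi⟩ := exists_chart_X_eq t
  obtain ⟨g, hg⟩ := hX1
  induction h using MvPolynomial.induction_on with
  | C a => exact ⟨0, C a, by simp [← algebraMap_eq]⟩
  | add p q hp hq =>
    obtain ⟨m, f, hf⟩ := hp
    obtain ⟨n, f', hf'⟩ := hq
    refine ⟨m + n, X i ^ n * f + X i ^ m * f', ?_⟩
    rw [map_add, map_mul, map_mul, map_pow, map_pow, hi, hf, hf']
    ring
  | mul_X p j hp =>
    obtain ⟨m, f, hf⟩ := hp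
    fin_cases j
    · exact ⟨m, f * X i, by rw [map_mul, hf, hi, mul_assoc]; rfl⟩
    · exact ⟨m + 1, f * g, by rw [map_mul, hf, hg, pow_succ]; simp only [Fin.mk_one]; ring⟩

/-- Every regular function on the last chart is a quotient of functions on the plane, with the
denominator supported on the exceptional curves. -/
theorem exists_pullback_eq_mul (l : List ExcPoint) (h : Plane) :
    ∃ (f g : Plane), ∃ e ∈ excMonoid l, pullback l g = e ∧ pullback l f = e * h := by
  induction l with
  | nil => exact ⟨h, 1, 1, one_mem _, rfl, (one_mul _).symm⟩
  | cons t ts ih =>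
    obtain ⟨f₁, g₁, e, he, hg₁, hf₁⟩ := ih
    obtain ⟨m, f, hf⟩ := exists_chart_eq_X_pow_mul t f₁
    obtain ⟨n, g, hg⟩ := exists_chart_eq_X_pow_mul t g₁
    obtain ⟨i, hi⟩ := exists_chart_X_eq t
    refine ⟨X i ^ n * f, X i ^ m * g, pullback ts (X 0) ^ (m + n) * e,
      mul_mem (pow_mem (pullback_X_mem_excMonoid t ts) _) (excMonoid_le_cons t ts he), ?_, ?_⟩
    · change pullback ts (chart t (X i ^ m * g)) = _
      rw [map_mul, map_pow, hi, hg, map_mul, map_mul, map_pow, map_pow, hg₁]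
      ring
    · change pullback ts (chart t (X i ^ n * f)) = _
      rw [map_mul, map_pow, hi, hf, map_mul, map_mul, map_pow, map_pow, hf₁]
      ring

/-- Power series of the form `x ^ n` times a unit. -/
def xMonomial : Submonoid Germ where
  carrier := {f | ∃ (n : ℕ) (u : Germ), IsUnit u ∧ f = MvPowerSeries.X 0 ^ n * u}
  one_mem' := ⟨0, 1, isUnit_one, by simp⟩
  mul_mem' := by
    rintro _ _ ⟨n, u, hu, rfl⟩ ⟨m, v, hv, rfl⟩
    exact ⟨n + m, u * v, hu.mul hv, by ring⟩

theorem isUnit_coe_iff {f : Plane} : IsUnit (f : Germ) ↔ constantCoeff f ≠ 0 := by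
  rw [MvPowerSeries.isUnit_iff_constantCoeff, isUnit_iff_ne_zero,
    ← MvPowerSeries.coeff_zero_eq_constantCoeff_apply, MvPolynomial.coeff_coe]
  rfl

/-- At a general point of the last exceptional curve, the other exceptional curves do not pass
through the point. -/
theorem coe_mem_xMonomial {l : List ExcPoint} {q : ExcPoint}
    (hq : ∀ j, 1 ≤ j → j ≤ l.length → constantCoeff (strictTransform (l.drop j ++ [q]) (X 0)) ≠ 0)
    {e : Plane} (he : e ∈ excMonoid (l ++ [q])) : (e : Germ) ∈ xMonomial := by
  have main : excMonoid (l ++ [q]) ≤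
      xMonomial.comap (coeToMvPowerSeries.ringHom : Plane →+* Germ) := by
    clear he
    induction l with
    | nil =>
      refine sup_le ((Submonoid.closure_le).2 ?_) bot_le
      rintro _ rfl
      exact ⟨1, 1, isUnit_one, by simp [pullback]⟩
    | cons t ts ih =>
      have ih' := ih fun j h1 h2 => by
        have := hq (j + 1) (by omega) (by simpa using h2)
        simpa using this
      refine sup_le ((Submonoid.closure_le).2 ?_) ih'
      rintro _ rfl
      obtain ⟨e', he', h⟩ := pullback_eq_mul_strictTransform (ts ++ [q]) (X 0)
      change ((pullback (ts ++ [q]) (X 0) : Plane) : Germ) ∈ xMonomial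
      rw [h, MvPolynomial.coe_mul]
      -- The total transform of this exceptional curve consists of later exceptional curves and its
      -- strict transform, which misses the free point and so is a unit there.
      refine mul_mem (ih' he') ⟨0, _, isUnit_coe_iff.2 ?_, by simp; rfl⟩
      simpa using hq 1 le_rfl (by simp)
  exact main he

theorem Cluster.IsFree.coe_mem_xMonomial {K : Cluster} {q : ExcPoint} (hq : K.IsFree q) {e : Plane}
    (he : e ∈ excMonoid (K.points ++ [q])) : (e : Germ) ∈ xMonomial :=
  PlaneVal.coe_mem_xMonomial hq he


/-! ### Homogeneous components and blow-ups -/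

/-- The blow-up of the origin divides homogeneous polynomials of degree `n` exactly by `x ^ n`. -/
theorem chart_of_isHomogeneous (t : ExcPoint) {f : Plane} {n : ℕ} (hf : f.IsHomogeneous n)
    (hf0 : f ≠ 0) : ∃ g : Plane, chart t f = X 0 ^ n * g ∧ ¬ (X 0 : Plane) ∣ g := by
  -- Here `b` is the chart with its factor x removed. It involves only y, so setting x = 0 fixes it;
  -- a multiple of x that is fixed in this way must vanish.
  obtain ⟨b, hb, hσ⟩ : ∃ b : Fin 2 → Plane, (∀ i, chart t (X i) = X 0 * b i) ∧
      ∀ i, aeval ![(0 : Plane), X 1] (b i) = b i := by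
    cases t with
    | slope c => exact ⟨![1, X 1 + C c], fun i => by fin_cases i <;> simp [chart],
        fun i => by fin_cases i <;> simp [← algebraMap_eq]⟩
    | vertical => exact ⟨![X 1, 1], fun i => by fin_cases i <;> simp [chart],
        fun i => by fin_cases i <;> simp⟩
  have h1 : chart t f = X 0 ^ n * aeval b f := by
    have h2 : chart t = aeval fun i => X 0 * b i :=
      MvPolynomial.algHom_ext fun i => by rw [hb, aeval_X]
    rw [h2, aeval_def, aeval_def, eval₂_eq, eval₂_eq, Finset.mul_sum]
    refine Finset.sum_congr rfl fun d hd => ?_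
    have h3 : ∑ i ∈ d.support, d i = n := by
      rw [← hf (mem_support_iff.1 hd), Finsupp.weight_apply]
      simp [Finsupp.sum]
    simp only [mul_pow, Finset.prod_mul_distrib, Finset.prod_pow_eq_pow_sum, h3]
    ring
  refine ⟨aeval b f, h1, ?_⟩
  rintro ⟨g, hg⟩
  have h4 : aeval ![(0 : Plane), X 1] (aeval b f) = aeval b f := by
    have : ((aeval ![(0 : Plane), X 1] : Plane →ₐ[ℂ] Plane).comp (aeval b : Plane →ₐ[ℂ] Plane)) = aeval b :=
      MvPolynomial.algHom_ext fun i => by rw [AlgHom.comp_apply, aeval_X, hσ]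
    exact congrArg (fun φ : Plane →ₐ[ℂ] Plane => φ f) this
  have h5 : aeval b f = 0 := by
    rw [← h4, hg, map_mul]
    simp
  rw [h5, mul_zero] at h1
  exact (map_ne_zero_iff _ (chart_injective t)).2 hf0 h1

/-- The lowest homogeneous component, of degree m, contributes exactly x ^ m and the others at least
x ^ (m + 1). The right side does not mention `t`: the order is the multiplicity at the centre,
whatever the chart. -/
theorem X_pow_dvd_chart_iff (t : ExcPoint) {f : Plane} {n : ℕ} :
    (X 0 : Plane) ^ n ∣ chart t f ↔ ∀ d, Finsupp.degree d < n → coeff d f = 0 := by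
  constructor
  · intro h
    by_contra! hcon
    have hex : ∃ m, ∃ d, Finsupp.degree d = m ∧ coeff d f ≠ 0 := by
      obtain ⟨d, -, hd⟩ := hcon
      exact ⟨_, d, rfl, hd⟩
    classical
    obtain ⟨d₀, hd₀, hd₀'⟩ := Nat.find_spec hex
    have hmin : ∀ d, Finsupp.degree d < Nat.find hex → coeff d f = 0 := fun d hd => by
      by_contra h'
      exact Nat.find_min hex hd ⟨d, rfl, h'⟩
    generalize Nat.find hex = m at hd₀ hmin
    have hmn : m < n := by
      obtain ⟨d, hd, hd'⟩ := hcon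
      by_contra! hle
      exact hd' (hmin d (lt_of_lt_of_le hd hle))
    have hne : homogeneousComponent m f ≠ 0 := by
      intro h0
      have := congrArg (coeff d₀) h0
      rw [coeff_homogeneousComponent, if_pos hd₀] at this
      exact hd₀' this
    obtain ⟨g, hg, hg'⟩ := chart_of_isHomogeneous t (homogeneousComponent_isHomogeneous m f) hne
    have hrest : (X 0 : Plane) ^ (m + 1) ∣ chart t (f - homogeneousComponent m f) := by
      rw [← coe_X_pow_dvd_iff, ← chartGerm_coe]
      refine X_pow_dvd_chartGerm t fun d hd => ?_
      rw [MvPolynomial.coeff_coe, coeff_sub, coeff_homogeneousComponent]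
      rcases Nat.lt_succ_iff_lt_or_eq.1 hd with hd | hd
      · rw [hmin d hd, if_neg (by omega), sub_zero]
      · rw [if_pos hd, sub_self]
    have h2 : (X 0 : Plane) ^ (m + 1) ∣ chart t (homogeneousComponent m f) := by
      have := dvd_sub ((pow_dvd_pow (X 0) hmn).trans h) hrest
      rwa [← map_sub, sub_sub_cancel] at this
    rw [hg, pow_succ] at h2
    exact hg' ((mul_dvd_mul_iff_left (pow_ne_zero _ (X_ne_zero _))).1 h2)
  · intro h
    rw [← coe_X_pow_dvd_iff, ← chartGerm_coe]
    exact X_pow_dvd_chartGerm t fun d hd => by rw [MvPolynomial.coeff_coe, h d hd]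

theorem pullback_append (l : List ExcPoint) (q : ExcPoint) (f : Plane) :
    pullback (l ++ [q]) f = chart q (pullback l f) := by
  induction l generalizing f with
  | nil => rfl
  | cons t ts ih => exact ih _

/-- The order of vanishing along the last exceptional curve can be computed at any of its
points. -/
theorem X_pow_dvd_pullback_append_iff (l : List ExcPoint) (q q' : ExcPoint) {f : Plane} {n : ℕ} :
    (X 0 : Plane) ^ n ∣ pullback (l ++ [q]) f ↔ (X 0 : Plane) ^ n ∣ pullback (l ++ [q']) f := by
  rw [pullback_append, pullback_append, X_pow_dvd_chart_iff, X_pow_dvd_chart_iff]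

/-! ### General points exist -/

/-- The constant term of the strict transform at the point of slope `c` is a polynomial in `c`. -/
theorem finite_constantCoeff_strictStep_eq_zero {f : Plane} (hf : f ≠ 0) :
    {c : ℂ | constantCoeff (strictStep (.slope c) f) = 0}.Finite := by
  obtain ⟨p, hp, hpc⟩ : ∃ p : Polynomial ℂ, p ≠ 0 ∧
      ∀ c, constantCoeff (strictStep (.slope c) f) = p.eval c := by
    let τ : ℂ → Plane →ₐ[ℂ] Plane := fun c => aeval ![X 0, X 1 + C c]
    -- Charts at different slopes differ by a translation of y. The constant term at slope c is thus
    -- the value at y = c of the strict transform at slope 0, restricted to x = 0.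
    have hτ : ∀ c, chart (.slope c) = (τ c).comp (chart (.slope 0)) := fun c =>
      MvPolynomial.algHom_ext fun i => by fin_cases i <;> simp [chart, τ]
    obtain ⟨m, hm⟩ := chart_eq_X_pow_mul_strictStep (.slope 0) f
    set G := strictStep (.slope 0) f with hG
    have hGX : ¬ (X 0 : Plane) ∣ G := not_X_dvd_strictStep _ hf
    have hstep : ∀ c, strictStep (.slope c) f = τ c G := by
      intro c
      have h1 : chart (.slope c) f = X 0 ^ m * τ c G := by
        rw [hτ, AlgHom.comp_apply, hm, map_mul, map_pow]
        simp [τ]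
      obtain ⟨m', hm'⟩ := chart_eq_X_pow_mul_strictStep (.slope c) f
      have hmm : m' = m := by
        refine le_antisymm ?_ ?_
        · by_contra! hlt
          have h2 : (X 0 : Plane) ^ (m + 1) ∣ chart (.slope 0) f := by
            rw [X_pow_dvd_chart_iff, ← X_pow_dvd_chart_iff (.slope c), hm']
            exact (pow_dvd_pow _ hlt).mul_right _
          rw [hm, pow_succ] at h2
          exact hGX ((mul_dvd_mul_iff_left (pow_ne_zero _ (X_ne_zero _))).1 h2)
        · by_contra! hlt
          have h2 : (X 0 : Plane) ^ (m' + 1) ∣ chart (.slope c) f := by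
            rw [h1]
            exact (pow_dvd_pow _ hlt).mul_right _
          rw [hm', pow_succ] at h2
          exact not_X_dvd_strictStep _ hf
            ((mul_dvd_mul_iff_left (pow_ne_zero _ (X_ne_zero _))).1 h2)
      rw [hm', hmm] at h1
      exact mul_left_cancel₀ (pow_ne_zero _ (X_ne_zero _)) h1
    let π : Plane →ₐ[ℂ] Polynomial ℂ := aeval ![0, Polynomial.X]
    refine ⟨π G, fun h0 => hGX ?_, fun c => ?_⟩
    · have h1 : ∀ g : Plane, (X 0 : Plane) ∣ g - Polynomial.aeval (X 1 : Plane) (π g) := by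
        intro g
        induction g using MvPolynomial.induction_on with
        | C a => simp [π, ← algebraMap_eq]
        | add p q hp hq =>
          have := dvd_add hp hq
          rwa [← add_sub_add_comm, ← map_add, ← map_add] at this
        | mul_X p i hp =>
          fin_cases i
          · simp [π]
          · have := hp.mul_right (X 1)
            rw [sub_mul] at this
            simpa [π] using this
      simpa [h0] using h1 G
    · rw [hstep]
      have : (constantCoeff : Plane →+* ℂ).comp (τ c : Plane →+* Plane) =
          (Polynomial.evalRingHom c).comp (π : Plane →+* Polynomial ℂ) := by
        apply MvPolynomial.ringHom_ext
        · intro r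
          simp [π, τ, ← algebraMap_eq]
        · intro i
          fin_cases i <;> simp [π, τ]
      exact congrArg (fun φ : Plane →+* ℂ => φ G) this
  simp_rw [hpc]
  exact Polynomial.finite_setOfPred_isRoot hp

/-- Each earlier exceptional curve excludes only finitely many slopes, and ℂ is infinite. -/
theorem Cluster.exists_isFree (K : Cluster) : ∃ q, K.IsFree q := by
  have hfin : (⋃ j ∈ Finset.range (K.points.length + 1), {c : ℂ | constantCoeff
      (strictStep (.slope c) (strictTransform (K.points.drop j) (X 0))) = 0}).Finite :=
    Set.Finite.biUnion (Finset.finite_toSet _) fun j _ =>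
      finite_constantCoeff_strictStep_eq_zero (strictTransform_ne_zero _ (X_ne_zero _))
  obtain ⟨c, hc⟩ := hfin.exists_notMem
  refine ⟨.slope c, fun j _ hj h0 => hc ?_⟩
  rw [strictTransform_append] at h0
  exact Set.mem_biUnion (Finset.mem_coe.2 (Finset.mem_range.2 (Nat.lt_succ_of_le hj))) h0

/-! ### Power series in two variables as iterated power series -/

theorem exists_algEquiv_powerSeries : ∃ Φ : Germ ≃ₐ[ℂ] PowerSeries (PowerSeries ℂ),
    Φ (MvPowerSeries.X 1) = PowerSeries.C PowerSeries.X ∧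
    Φ (MvPowerSeries.X 0) = PowerSeries.X ∧
    ∀ (f : Germ) (i j : ℕ), PowerSeries.coeff i (PowerSeries.coeff j (Φ f)) =
      MvPowerSeries.coeff (Finsupp.single 0 j + Finsupp.single 1 i) f := by
  let r : MvPowerSeries (Fin 1) ℂ ≃ₐ[ℂ] PowerSeries ℂ :=
    MvPowerSeries.renameEquiv ℂ (Equiv.ofUnique (Fin 1) Unit)
  let Ψ : PowerSeries (MvPowerSeries (Fin 1) ℂ) ≃ₐ[ℂ] PowerSeries (PowerSeries ℂ) :=
    AlgEquiv.ofAlgHom (PowerSeries.mapAlgHom (r : MvPowerSeries (Fin 1) ℂ →ₐ[ℂ] PowerSeries ℂ))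
      (PowerSeries.mapAlgHom (r.symm : PowerSeries ℂ →ₐ[ℂ] MvPowerSeries (Fin 1) ℂ))
      (by ext f n : 2; simp [PowerSeries.mapAlgHom_apply])
      (by ext f n : 2; simp [PowerSeries.mapAlgHom_apply])
  have hΨ : ∀ f, Ψ f = PowerSeries.map (r : MvPowerSeries (Fin 1) ℂ →+* PowerSeries ℂ) f :=
    fun f => PowerSeries.mapAlgHom_apply (r : MvPowerSeries (Fin 1) ℂ →ₐ[ℂ] PowerSeries ℂ) f
  refine ⟨(MvPowerSeries.finSuccEquiv ℂ 1).trans Ψ, ?_, ?_, ?_⟩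
  · have := MvPowerSeries.finSuccEquiv_X_succ (R := ℂ) (n := 1) 0
    rw [AlgEquiv.trans_apply, hΨ]
    change PowerSeries.map _ (MvPowerSeries.finSuccEquiv ℂ 1 (MvPowerSeries.X (Fin.succ 0))) = _
    rw [this, PowerSeries.map_C]
    congr 1
    exact MvPowerSeries.rename_X _ _
  · rw [AlgEquiv.trans_apply, hΨ, MvPowerSeries.finSuccEquiv_X_zero, PowerSeries.map_X]
  · intro f i j
    rw [AlgEquiv.trans_apply, hΨ, PowerSeries.coeff_map]
    have h1 : PowerSeries.coeff i (r (PowerSeries.coeff j (MvPowerSeries.finSuccEquiv ℂ 1 f))) =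
        MvPowerSeries.coeff (Finsupp.single 0 i) (PowerSeries.coeff j (MvPowerSeries.finSuccEquiv ℂ 1 f)) := by
      have := MvPowerSeries.coeff_embDomain_rename (R := ℂ) (Equiv.ofUnique (Fin 1) Unit).toEmbedding
        (PowerSeries.coeff j (MvPowerSeries.finSuccEquiv ℂ 1 f)) (Finsupp.single 0 i)
      rw [Finsupp.embDomain_single] at this
      exact this
    rw [RingHom.coe_coe, h1, MvPowerSeries.coeff_coeff_finSuccEquiv]
    congr 2
    ext k
    refine Fin.cases ?_ (fun k => ?_) k
    · simp
    · obtain rfl : k = 0 := Subsingleton.elim _ _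
      rw [Finsupp.cons_succ]
      simp

/-- Variant of `exists_algEquiv_powerSeries` in which `x` is the inner variable. -/
theorem exists_algEquiv_powerSeries' : ∃ Φ : Germ ≃ₐ[ℂ] PowerSeries (PowerSeries ℂ),
    Φ (MvPowerSeries.X 0) = PowerSeries.C PowerSeries.X ∧
    Φ (MvPowerSeries.X 1) = PowerSeries.X ∧
    ∀ (f : Germ) (i j : ℕ), PowerSeries.coeff i (PowerSeries.coeff j (Φ f)) =
      MvPowerSeries.coeff (Finsupp.single 1 j + Finsupp.single 0 i) f := by
  obtain ⟨Φ, h1, h2, h3⟩ := exists_algEquiv_powerSeries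
  refine ⟨(MvPowerSeries.renameEquiv ℂ (Equiv.swap 0 1)).trans Φ, ?_, ?_, fun f i j => ?_⟩
  · rw [AlgEquiv.trans_apply, ← h1]
    congr 1
    exact MvPowerSeries.rename_X _ _
  · rw [AlgEquiv.trans_apply, ← h2]
    congr 1
    exact MvPowerSeries.rename_X _ _
  · rw [AlgEquiv.trans_apply, h3]
    have := MvPowerSeries.coeff_embDomain_rename (R := ℂ) (Equiv.swap (0 : Fin 2) 1).toEmbedding f
      (Finsupp.single 1 j + Finsupp.single 0 i)
    rw [Finsupp.embDomain_add, Finsupp.embDomain_single, Finsupp.embDomain_single] at this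
    simpa using this

/-- A power series of Weierstrass degree one has a root. -/
theorem exists_ringHom_map_eq_zero {A : Type*} [CommRing A] [IsLocalRing A]
    [IsAdicComplete (IsLocalRing.maximalIdeal A) A] {b : PowerSeries A}
    (hord : (b.map (IsLocalRing.residue A)).order = (1 : ℕ)) :
    ∃ σ : PowerSeries A →+* A, (∀ c, σ (PowerSeries.C c) = c) ∧ σ b = 0 := by
  have hne : b.map (IsLocalRing.residue A) ≠ 0 := by
    intro h
    rw [h, PowerSeries.order_zero] at hord
    exact absurd hord (by simp)
  obtain ⟨f, h, hW⟩ := b.exists_isWeierstrassFactorization hne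
  have hdeg : f.natDegree = 1 := by
    rw [hW.natDegree_eq_toNat_order_map, hord]
    rfl
  have hf : Polynomial.aeval (-f.coeff 0) f = 0 := by
    have hm := hW.isDistinguishedAt.monic
    rw [Polynomial.Monic, Polynomial.leadingCoeff, hdeg] at hm
    rw [Polynomial.aeval_eq_sum_range, hdeg, Finset.sum_range_succ, Finset.sum_range_one, hm]
    simp
  let ev : (Polynomial A ⧸ Ideal.span {f}) →ₐ[A] A :=
    Ideal.Quotient.liftₐ _ (Polynomial.aeval (-f.coeff 0)) fun a ha => by
      obtain ⟨c, rfl⟩ := Ideal.mem_span_singleton'.1 ha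
      rw [map_mul, hf, mul_zero]
  -- Instead of evaluating a power series at the root, pass through A⟦v⟧/(b) ≅ A[v]/(f), where f is
  -- linear with root `-f.coeff 0`.
  let σ : PowerSeries A →ₐ[A] A :=
    (ev.comp (hW.algEquivQuotient.symm : _ →ₐ[A] _)).comp
      (Ideal.Quotient.mkₐ A (Ideal.span {b}))
  refine ⟨σ, fun c => σ.commutes c, ?_⟩
  change ev (hW.algEquivQuotient.symm (Ideal.Quotient.mk (Ideal.span {b}) b)) = 0
  rw [Ideal.Quotient.eq_zero_iff_mem.2 (Ideal.mem_span_singleton_self _), map_zero, map_zero]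

/-- A smooth germ transversal to `x = 0` is parametrized by `x`. -/
theorem exists_parametrization {b : Germ} (h0 : MvPowerSeries.constantCoeff b = 0)
    (h1 : MvPowerSeries.coeff (Finsupp.single 1 1) b ≠ 0) :
    ∃ ρ : Germ →ₐ[ℂ] PowerSeries ℂ, ρ (MvPowerSeries.X 0) = PowerSeries.X ∧ ρ b = 0 := by
  obtain ⟨Φ, hX, -, hcoeff⟩ := exists_algEquiv_powerSeries'
  have c0 : PowerSeries.constantCoeff (PowerSeries.coeff 0 (Φ b)) = 0 := by
    rw [← PowerSeries.coeff_zero_eq_constantCoeff_apply, hcoeff]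
    simpa using h0
  have c1 : PowerSeries.constantCoeff (PowerSeries.coeff 1 (Φ b)) ≠ 0 := by
    rw [← PowerSeries.coeff_zero_eq_constantCoeff_apply, hcoeff]
    simpa using h1
  have hres : ∀ c : PowerSeries ℂ, IsLocalRing.residue (PowerSeries ℂ) c = 0 ↔
      PowerSeries.constantCoeff c = 0 := fun c => by
    rw [IsLocalRing.residue_eq_zero_iff, ← PowerSeries.ker_coeff_eq_max_ideal, RingHom.mem_ker]
  -- Transversality to x = 0 means Weierstrass degree one in y.
  have hord : ((Φ b).map (IsLocalRing.residue (PowerSeries ℂ))).order = (1 : ℕ) := by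
    rw [PowerSeries.order_eq_nat]
    refine ⟨by rwa [PowerSeries.coeff_map, Ne, hres], fun i hi => ?_⟩
    obtain rfl : i = 0 := by omega
    rwa [PowerSeries.coeff_map, hres]
  obtain ⟨σ, hσC, hσb⟩ := exists_ringHom_map_eq_zero hord
  refine ⟨AlgHom.mk (σ.comp (Φ : Germ →+* PowerSeries (PowerSeries ℂ))) fun c => ?_, ?_, hσb⟩
  · have h2 := Φ.commutes c
    rw [PowerSeries.algebraMap_apply] at h2
    change σ (Φ (algebraMap ℂ Germ c)) = _
    rw [h2, hσC]
  · change σ (Φ (MvPowerSeries.X 0)) = _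
    rw [hX, hσC]

/-- The quotient of `ℂ⟦u, v⟧` by an irreducible `a`, vanishing on a branch along which the
coordinate `x` has order `M`, and by `x ^ n` is spanned by `n * M` elements. -/
theorem exists_spanning_of_irreducible (i : Fin 2) {ε : Germ →ₐ[ℂ] PowerSeries ℂ} {M : ℕ}
    (hM : 1 ≤ M) {w : PowerSeries ℂ} (hw : IsUnit w)
    (hε : ε (MvPowerSeries.X i) = PowerSeries.X ^ M * w)
    {a : Germ} (hirr : Irreducible a) (h0 : ε a = 0) (n : ℕ) :
    ∃ g : Fin n × Fin M → Germ, ∀ f, ∃ (c : Fin n × Fin M → ℂ) (q r : Germ),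
      f = ∑ j, c j • g j + a * q + MvPowerSeries.X i ^ n * r := by
  obtain ⟨Φ, hΦ⟩ : ∃ Φ : Germ ≃ₐ[ℂ] PowerSeries (PowerSeries ℂ),
      Φ (MvPowerSeries.X i) = PowerSeries.C PowerSeries.X := by
    fin_cases i
    · exact ⟨_, exists_algEquiv_powerSeries'.choose_spec.1⟩
    · exact ⟨_, exists_algEquiv_powerSeries.choose_spec.1⟩
  have hΦ' : Φ.symm (PowerSeries.C PowerSeries.X) = MvPowerSeries.X i := by
    rw [← hΦ, AlgEquiv.symm_apply_apply]
  obtain ⟨g, hg⟩ := exists_spanning_of_branch (ε := ε.comp (Φ.symm : _ →ₐ[ℂ] _)) hM hw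
    (a := Φ a) (by simp [hΦ', hε]) ((MulEquiv.irreducible_iff Φ).2 hirr)
    (by simp [h0]) n
  refine ⟨fun j => Φ.symm (g j), fun f => ?_⟩
  obtain ⟨c, q, r, h⟩ := hg (Φ f)
  refine ⟨c, Φ.symm q, Φ.symm r, ?_⟩
  have := congrArg Φ.symm h
  rw [AlgEquiv.symm_apply_apply] at this
  rw [this]
  simp [hΦ']


/-! ### Dimension counts -/

section Dimension

variable {k V W V₁ V₂ ι : Type*} [Field k] [AddCommGroup V] [Module k V] [AddCommGroup W]
  [Module k W] [AddCommGroup V₁] [Module k V₁] [AddCommGroup V₂] [Module k V₂] [Fintype ι]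

theorem finrank_quotient_eq (φ : V →ₗ[k] W) (Q : Submodule k W) (h : ∀ w, ∃ v, w - φ v ∈ Q) :
    Module.finrank k (V ⧸ Q.comap φ) = Module.finrank k (W ⧸ Q) := by
  refine LinearEquiv.finrank_eq (LinearEquiv.ofBijective (Submodule.mapQ (Q.comap φ) Q φ le_rfl)
    ⟨?_, ?_⟩)
  · rw [← LinearMap.ker_eq_bot, Submodule.ker_mapQ, Submodule.mkQ_map_self]
  · intro w
    obtain ⟨w, rfl⟩ := Submodule.mkQ_surjective _ w
    obtain ⟨v, hv⟩ := h w
    refine ⟨Submodule.mkQ _ v, ?_⟩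
    rw [Submodule.mkQ_apply, Submodule.mapQ_apply, Submodule.mkQ_apply, eq_comm,
      Submodule.Quotient.eq]
    exact hv

/-- The hypothesis says that the induced map from the two quotients and k^ι is onto. The Bézout
count uses both summands; the colength recursion takes the second to be zero. -/
theorem finrank_quotient_le (P : Submodule k V) (P₁ : Submodule k V₁) (P₂ : Submodule k V₂)
    [Module.Finite k (V₁ ⧸ P₁)] [Module.Finite k (V₂ ⧸ P₂)]
    (L₁ : V₁ →ₗ[k] V) (L₂ : V₂ →ₗ[k] V) (g : ι → V) (h₁ : P₁ ≤ P.comap L₁) (h₂ : P₂ ≤ P.comap L₂)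
    (h : ∀ v, ∃ v₁ v₂, ∃ c : ι → k, v - (L₁ v₁ + L₂ v₂ + ∑ i, c i • g i) ∈ P) :
    Module.finrank k (V ⧸ P) ≤
      Module.finrank k (V₁ ⧸ P₁) + Module.finrank k (V₂ ⧸ P₂) + Fintype.card ι := by
  let φ : ((V₁ ⧸ P₁) × (V₂ ⧸ P₂)) × (ι → k) →ₗ[k] V ⧸ P :=
    ((P₁.mapQ P L₁ h₁).coprod (P₂.mapQ P L₂ h₂)).coprod (P.mkQ ∘ₗ Fintype.linearCombination k g)
  have hφ : Function.Surjective φ := by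
    intro v
    obtain ⟨v, rfl⟩ := Submodule.mkQ_surjective _ v
    obtain ⟨v₁, v₂, c, hv⟩ := h v
    refine ⟨((P₁.mkQ v₁, P₂.mkQ v₂), c), ?_⟩
    have : φ ((P₁.mkQ v₁, P₂.mkQ v₂), c) = P.mkQ (L₁ v₁ + L₂ v₂ + ∑ i, c i • g i) := by
      rw [map_add, map_add, ← Fintype.linearCombination_apply]
      rfl
    rw [this, eq_comm, Submodule.mkQ_apply, Submodule.mkQ_apply, Submodule.Quotient.eq]
    exact hv
  have := LinearMap.finrank_le_finrank_of_surjective hφ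
  simpa using this

theorem le_finrank_quotient (P : Submodule k V) [Module.Finite k (V ⧸ P)] (P₁ : Submodule k V₁)
    (L : V₁ →ₗ[k] V) (g : ι → V) (h₁ : P₁ ≤ P.comap L)
    (h : ∀ v (c : ι → k), L v + ∑ i, c i • g i ∈ P → v ∈ P₁ ∧ c = 0) :
    Module.finrank k (V₁ ⧸ P₁) + Fintype.card ι ≤ Module.finrank k (V ⧸ P) := by
  let φ : (V₁ ⧸ P₁) × (ι → k) →ₗ[k] V ⧸ P :=
    (P₁.mapQ P L h₁).coprod (P.mkQ ∘ₗ Fintype.linearCombination k g)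
  have hφ : Function.Injective φ := by
    rw [injective_iff_map_eq_zero]
    rintro ⟨v, c⟩ hv
    obtain ⟨v, rfl⟩ := Submodule.mkQ_surjective _ v
    have h2 : φ (P₁.mkQ v, c) = P.mkQ (L v + ∑ i, c i • g i) := by
      rw [map_add, ← Fintype.linearCombination_apply]
      rfl
    rw [h2, Submodule.mkQ_apply, Submodule.Quotient.mk_eq_zero] at hv
    obtain ⟨hv, hc⟩ := h v c hv
    rw [hc, Prod.mk_eq_zero, Submodule.mkQ_apply, Submodule.Quotient.mk_eq_zero]
    exact ⟨hv, rfl⟩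
  have := Module.Finite.of_injective φ hφ
  have : Module.Finite k (V₁ ⧸ P₁) :=
    Module.Finite.of_injective (φ ∘ₗ LinearMap.inl k _ _) (hφ.comp LinearMap.inl_injective)
  have := LinearMap.finrank_le_finrank_of_injective hφ
  simpa using this

end Dimension

/-- Series of distinct orders below c + m are independent modulo X ^ (c + m): the lowest order
present cannot cancel. -/
theorem eq_zero_of_X_pow_dvd_sum {c m : ℕ} (v u : Fin m → PowerSeries ℂ) (hu : ∀ i, IsUnit (u i))
    (hv : ∀ i, v i = PowerSeries.X ^ (c + i : ℕ) * u i) {a : Fin m → ℂ}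
    (h : PowerSeries.X ^ (c + m) ∣ ∑ i, a i • v i) : a = 0 := by
  have key : ∀ n : ℕ, ∀ i : Fin m, (i : ℕ) = n → a i = 0 := by
    intro n
    induction n using Nat.strong_induction_on with
    | _ n ih =>
      rintro i rfl
      have h1 := PowerSeries.X_pow_dvd_iff.1 h (c + i) (by omega)
      rw [map_sum, Finset.sum_eq_single i] at h1
      · rw [PowerSeries.coeff_smul, hv, PowerSeries.coeff_X_pow_mul', if_pos le_rfl, Nat.sub_self,
          PowerSeries.coeff_zero_eq_constantCoeff_apply, smul_eq_mul] at h1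
        exact (mul_eq_zero.1 h1).resolve_right
          (PowerSeries.isUnit_iff_constantCoeff.1 (hu i)).ne_zero
      · intro j _ hj
        rcases lt_or_gt_of_ne hj with hlt | hgt
        · rw [ih j hlt j rfl, zero_smul, map_zero]
        · rw [PowerSeries.coeff_smul, hv, PowerSeries.coeff_X_pow_mul', if_neg, smul_zero]
          have : (i : ℕ) < j := hgt
          omega
      · simp
  exact funext fun i => key i i rfl

/-! ### The colength of the valuation ideals -/

/-- The germs vanishing to order at least `n` along the last exceptional curve. -/
def germSub (l : List ExcPoint) (n : ℕ) : Submodule ℂ Germ :=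
  (Submodule.restrictScalars ℂ (Ideal.span {(MvPowerSeries.X 0 : Germ) ^ n})).comap
    (pullGerm l).toLinearMap

theorem mem_germSub {l : List ExcPoint} {n : ℕ} {f : Germ} :
    f ∈ germSub l n ↔ MvPowerSeries.X 0 ^ n ∣ pullGerm l f := by
  rw [germSub, Submodule.mem_comap, Submodule.restrictScalars_mem, AlgHom.toLinearMap_apply,
    Ideal.mem_span_singleton]

theorem exists_polynomial_approx (f : Germ) (n : ℕ) :
    ∃ p : Plane, p.totalDegree ≤ n ∧
      ∀ d, Finsupp.degree d < n → MvPowerSeries.coeff d (f - (p : Germ)) = 0 := by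
  refine ⟨MvPowerSeries.truncTotal n f, ?_, fun d hd => ?_⟩
  · rcases eq_or_ne n 0 with rfl | hn
    · have : MvPowerSeries.truncTotal 0 f = 0 := by
        ext d
        rw [MvPowerSeries.coeff_truncTotal_eq_zero _ (Nat.zero_le _), coeff_zero]
      rw [this, totalDegree_zero]
    · exact (MvPowerSeries.totalDegree_truncTotal_lt _ hn).le
  · rw [map_sub, MvPolynomial.coeff_coe, MvPowerSeries.coeff_truncTotal _ hd, sub_self]

theorem finite_quotient_germSub {l : List ExcPoint} (hl : l ≠ []) (n : ℕ) :
    Module.Finite ℂ (Germ ⧸ germSub l n) := by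
  let φ : restrictTotalDegree (Fin 2) ℂ n →ₗ[ℂ] Germ ⧸ germSub l n :=
    (germSub l n).mkQ ∘ₗ (coeToMvPowerSeries.algHom ℂ : Plane →ₐ[ℂ] Germ).toLinearMap ∘ₗ
      Submodule.subtype _
  refine Module.Finite.of_surjective φ fun v => ?_
  obtain ⟨f, rfl⟩ := Submodule.mkQ_surjective _ v
  obtain ⟨p, hp, hpf⟩ := exists_polynomial_approx f n
  refine ⟨⟨p, (mem_restrictTotalDegree _ _ _).2 hp⟩, ?_⟩
  have : φ ⟨p, (mem_restrictTotalDegree _ _ _).2 hp⟩ = (germSub l n).mkQ (p : Germ) := by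
    simp [φ, coeToMvPowerSeries.algHom_apply]
  rw [this, eq_comm, Submodule.mkQ_apply, Submodule.mkQ_apply, Submodule.Quotient.eq, mem_germSub]
  exact X_pow_dvd_pullGerm hl hpf

/-- The total transform of `b` is `x ^ N` times the equation of a smooth germ transversal to the
exceptional curve `x = 0`. -/
def IsTransversal (l : List ExcPoint) (b : Germ) (N : ℕ) : Prop :=
  ∃ b' : Germ, pullGerm l b = MvPowerSeries.X 0 ^ N * b' ∧ MvPowerSeries.constantCoeff b' = 0 ∧
    MvPowerSeries.coeff (Finsupp.single 1 1) b' ≠ 0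

theorem ringHom_xMonomial {ρ : Germ →ₐ[ℂ] PowerSeries ℂ}
    (hρ : ρ (MvPowerSeries.X 0) = PowerSeries.X) {f : Germ} (hf : f ∈ xMonomial) :
    ∃ (n : ℕ) (u : PowerSeries ℂ), IsUnit u ∧ ρ f = PowerSeries.X ^ n * u ∧
      MvPowerSeries.X 0 ^ n ∣ f := by
  obtain ⟨n, u, hu, rfl⟩ := hf
  exact ⟨n, ρ u, hu.map ρ, by rw [map_mul, map_pow, hρ], dvd_mul_right _ _⟩

/-- Restriction to a transversal branch. -/
theorem exists_restriction {t : ExcPoint} {ts : List ExcPoint}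
    (hE : ∀ e ∈ excMonoid (t :: ts), (e : Germ) ∈ xMonomial) {b : Germ} {N : ℕ}
    (hb : IsTransversal (t :: ts) b N) :
    ∃ ε : Germ →ₐ[ℂ] PowerSeries ℂ, ε b = 0 ∧
      (∀ f n, f ∈ germSub (t :: ts) n → PowerSeries.X ^ n ∣ ε f) ∧
      (∃ (i : Fin 2) (M : ℕ) (w : PowerSeries ℂ), 1 ≤ M ∧ IsUnit w ∧
        ε (MvPowerSeries.X i) = PowerSeries.X ^ M * w ∧ MvPowerSeries.X i ∈ germSub (t :: ts) M) ∧
      ∃ (f g : Germ) (n : ℕ) (u v : PowerSeries ℂ), IsUnit u ∧ IsUnit v ∧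
        ε g = PowerSeries.X ^ n * u ∧ ε f = PowerSeries.X ^ (n + 1) * v := by
  obtain ⟨b', hb1, hb2, hb3⟩ := hb
  obtain ⟨ρ, hρX, hρb⟩ := exists_parametrization hb2 hb3
  refine ⟨ρ.comp (pullGerm (t :: ts)), ?_, ?_, ?_, ?_⟩
  · rw [AlgHom.comp_apply, hb1, map_mul, hρb, mul_zero]
  · intro f n hf
    have := map_dvd ρ (mem_germSub.1 hf)
    rwa [map_pow, hρX] at this
  · obtain ⟨i, hi⟩ := exists_chart_X_eq t
    have h1 : pullGerm (t :: ts) (MvPowerSeries.X i) = (pullback ts (X 0) : Plane) := by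
      rw [← MvPolynomial.coe_X, pullGerm_coe]
      congr 1
      exact congrArg (pullback ts) hi
    -- At a free point this coordinate is x ^ M times a unit, so its value and its order on the
    -- branch are both accounted for by the same M.
    obtain ⟨M, w, hw, hM, hdvd⟩ := ringHom_xMonomial hρX
      (hE _ (pullback_X_mem_excMonoid t ts))
    refine ⟨i, M, w, ?_, hw, by rw [AlgHom.comp_apply, h1, hM], mem_germSub.2 (by rwa [h1])⟩
    by_contra! hM0
    obtain rfl : M = 0 := by omega
    have h2 := map_dvd ρ (coe_X_pow_dvd_iff (n := 1).2 (by simpa using X_dvd_pullback_X ts))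
    rw [hM, map_pow, hρX, pow_zero, one_mul, pow_one] at h2
    exact PowerSeries.X_irreducible.not_isUnit (isUnit_of_dvd_unit h2 hw)
  -- By birationality x is a quotient f/g of functions on the plane; on the branch f and g have
  -- consecutive orders.
  · obtain ⟨f, g, e, he, hg, hf⟩ := exists_pullback_eq_mul (t :: ts) (X 0)
    obtain ⟨n, u, hu, hn, -⟩ := ringHom_xMonomial hρX (hE e he)
    refine ⟨f, g, n, u, u, hu, hu, ?_, ?_⟩
    · rw [AlgHom.comp_apply, pullGerm_coe, hg, hn]
    · rw [AlgHom.comp_apply, pullGerm_coe, hf, MvPolynomial.coe_mul, map_mul, hn, coe_X, hρX]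
      ring

/-- The cofactor of x ^ N is not divisible by x, so b has value exactly N. Truncated subtraction
covers n < N, where both sides hold. -/
theorem mul_mem_germSub_iff {l : List ExcPoint} {b : Germ} {N : ℕ} (hb : IsTransversal l b N)
    {f : Germ} {n : ℕ} : b * f ∈ germSub l n ↔ f ∈ germSub l (n - N) := by
  obtain ⟨b', hb1, -, hb3⟩ := hb
  rw [mem_germSub, mem_germSub, map_mul]
  exact X_pow_dvd_mul_iff hb1 (not_X_dvd_of_coeff hb3)

/-- The growth of the colength of the valuation ideals, measured by an irreducible transversal
germ. -/
theorem exists_colength_sub_bound {t : ExcPoint} {ts : List ExcPoint}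
    (hE : ∀ e ∈ excMonoid (t :: ts), (e : Germ) ∈ xMonomial) {b : Germ} {N : ℕ}
    (hb : IsTransversal (t :: ts) b N) (hirr : Irreducible b) :
    ∃ C : ℕ, ∀ n,
      Module.finrank ℂ (Germ ⧸ germSub (t :: ts) n) ≤
        Module.finrank ℂ (Germ ⧸ germSub (t :: ts) (n - N)) + n + C ∧
      Module.finrank ℂ (Germ ⧸ germSub (t :: ts) (n - N)) + n ≤
        Module.finrank ℂ (Germ ⧸ germSub (t :: ts) n) + C := by
  obtain ⟨ε, hεb, hε, ⟨i, M, w, hM, hw, hεM, hXM⟩, f, g, k, u, v, hu, hv, hg, hf⟩ :=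
    exists_restriction hE hb
  have hfin := fun n => finite_quotient_germSub (l := t :: ts) (by simp) n
  have hmul : ∀ n, germSub (t :: ts) (n - N) ≤
      (germSub (t :: ts) n).comap (LinearMap.mulLeft ℂ b) := fun n f hf =>
    (mul_mem_germSub_iff hb).2 hf
  -- M pays for rounding n up to a multiple of M; k * k is a bound beyond which every integer is a
  -- combination of k and k + 1.
  refine ⟨M + k * k, fun n => ⟨?_, ?_⟩⟩
  · obtain ⟨G, hG⟩ := exists_spanning_of_irreducible i hM hw hεM hirr hεb (n / M + 1)
    have h1 : (n / M + 1) * M ≤ n + M := by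
      rw [add_mul, one_mul]
      exact Nat.add_le_add_right (Nat.div_mul_le_self n M) M
    have h2 : n ≤ (n / M + 1) * M := by
      have := Nat.lt_div_mul_add (a := n) (b := M) (by omega)
      rw [add_mul, one_mul]
      omega
    have := hfin (n - N)
    have h3 := finrank_quotient_le (germSub (t :: ts) n) (germSub (t :: ts) (n - N))
      (⊥ : Submodule ℂ PUnit) (LinearMap.mulLeft ℂ b) 0 G (hmul n) (by simp) fun F => by
        obtain ⟨c, q, r, hF⟩ := hG F
        refine ⟨q, PUnit.unit, c, ?_⟩
        have h4 : F - (LinearMap.mulLeft ℂ b q + (0 : PUnit →ₗ[ℂ] Germ) PUnit.unit +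
            ∑ j, c j • G j) = MvPowerSeries.X i ^ (n / M + 1) * r := by
          rw [LinearMap.mulLeft_apply, LinearMap.zero_apply, add_zero]
          nth_rw 1 [hF]
          ring
        rw [h4, mem_germSub, map_mul, map_pow]
        refine Dvd.dvd.mul_right ?_ _
        refine (pow_dvd_pow _ h2).trans ?_
        rw [mul_comm, pow_mul]
        exact pow_dvd_pow_of_dvd (mem_germSub.1 hXM) _
    have h5 : Module.finrank ℂ (PUnit ⧸ (⊥ : Submodule ℂ PUnit)) = 0 :=
      Module.finrank_zero_of_subsingleton
    rw [h5, Fintype.card_prod, Fintype.card_fin, Fintype.card_fin] at h3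
    omega
  · by_cases hn : n ≤ k * k
    · have h1 : Module.finrank ℂ (Germ ⧸ germSub (t :: ts) (n - N)) ≤
          Module.finrank ℂ (Germ ⧸ germSub (t :: ts) n) := by
        have := hfin n
        have := le_finrank_quotient (germSub (t :: ts) n) (germSub (t :: ts) (n - N))
          (LinearMap.mulLeft ℂ b) (Fin.elim0 : Fin 0 → Germ) (hmul n) fun f c h =>
            ⟨(mul_mem_germSub_iff hb).1 (by simpa using h), Subsingleton.elim _ _⟩
        simpa using this
      omega
    obtain ⟨m, hm⟩ : ∃ m, n = k * k + m := ⟨n - k * k, by omega⟩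
    -- Divide by k: the quotient is at least k, hence exceeds the remainder, and q is the remainder.
    have hexp : ∀ j : Fin m, ∃ p q : ℕ, k * k + j = p * k + q * (k + 1) := by
      intro j
      rcases Nat.eq_zero_or_pos k with rfl | hk
      · exact ⟨0, j, by simp⟩
      · have h1 := Nat.div_add_mod (k * k + j) k
        have h2 := Nat.mod_lt (k * k + j) hk
        have h3 : k ≤ (k * k + j) / k := (Nat.le_div_iff_mul_le hk).2 (Nat.le_add_right _ _)
        obtain ⟨d, hd⟩ : ∃ d, (k * k + j) / k = (k * k + j) % k + d :=
          ⟨(k * k + j) / k - (k * k + j) % k, by omega⟩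
        refine ⟨d, (k * k + j) % k, ?_⟩
        generalize (k * k + (j : ℕ)) % k = r at *
        rw [hd] at h1
        rw [← h1]
        ring
    choose p q hpq using hexp
    have := hfin n
    -- On the branch multiples of b vanish, while these products have the orders k² + j for j < m,
    -- all below n = k² + m; hence they are independent modulo b and P_n.
    have h1 := le_finrank_quotient (germSub (t :: ts) n) (germSub (t :: ts) (n - N))
      (LinearMap.mulLeft ℂ b) (fun j : Fin m => g ^ p j * f ^ q j) (hmul n) fun F c h => by
        have h2 := hε _ _ h
        rw [map_add, LinearMap.mulLeft_apply, map_mul, hεb, zero_mul, zero_add, map_sum, hm] at h2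
        simp_rw [map_smul] at h2
        have hc : c = 0 := by
          refine eq_zero_of_X_pow_dvd_sum (c := k * k) _ (fun j => u ^ p j * v ^ q j)
            (fun j => (hu.pow _).mul (hv.pow _)) (fun j => ?_) h2
          rw [map_mul, map_pow, map_pow, hg, hf, hpq j]
          ring
        refine ⟨(mul_mem_germSub_iff hb).1 ?_, hc⟩
        simpa [hc] using h
    rw [Fintype.card_fin] at h1
    omega


/-! ### Values of polynomials -/

/-- The order of vanishing of a nonzero polynomial along the last exceptional curve. -/
def Cluster.ord (K : Cluster) (f : Plane) : ℕ :=
  multiplicity (X 0) (pullback (K.points ++ [.slope 0]) f)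

theorem Cluster.X_pow_dvd_pullback_iff (K : Cluster) (q : ExcPoint) {f : Plane} (hf : f ≠ 0)
    {n : ℕ} : (X 0 : Plane) ^ n ∣ pullback (K.points ++ [q]) f ↔ n ≤ K.ord f := by
  rw [X_pow_dvd_pullback_append_iff _ _ (.slope 0)]
  exact X_pow_dvd_iff_le_multiplicity ((map_ne_zero_iff _ (pullback_injective _)).2 hf)

theorem Cluster.polyVal_eq_ord (K : Cluster) {f : Plane} (hf : f ≠ 0) :
    K.polyVal f = ((K.ord f : ℤ) : WithTop ℤ) := by
  have h0 : pullback (K.points ++ [.slope 0]) f ≠ 0 :=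
    (map_ne_zero_iff _ (pullback_injective _)).2 hf
  have hfin : FiniteMultiplicity (X 0 : Plane) (pullback (K.points ++ [.slope 0]) f) :=
    FiniteMultiplicity.of_prime_left X_prime h0
  rw [K.polyVal_apply, hfin.emultiplicity_eq_multiplicity]
  rfl

theorem Cluster.le_polyVal_iff (K : Cluster) (q : ExcPoint) {f : Plane} {n : ℕ} :
    ((n : ℤ) : WithTop ℤ) ≤ K.polyVal f ↔ (X 0 : Plane) ^ n ∣ pullback (K.points ++ [q]) f := by
  by_cases hf : f = 0
  · simp [hf]
  · rw [K.X_pow_dvd_pullback_iff q hf, K.polyVal_eq_ord hf, WithTop.coe_le_coe, Nat.cast_le]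

theorem Cluster.valPoly_eq_ord (K : Cluster) {f : Plane} (hf : f ≠ 0) : K.valPoly f = K.ord f := by
  rw [Cluster.valPoly, Cluster.realVal, K.val_algebraMap, K.polyVal_eq_ord hf, WithTop.untopD_coe,
    Int.cast_natCast]

theorem Cluster.ord_mul (K : Cluster) {f g : Plane} (hf : f ≠ 0) (hg : g ≠ 0) :
    K.ord (f * g) = K.ord f + K.ord g := by
  have h := K.polyVal.map_mul f g
  rw [K.polyVal_eq_ord hf, K.polyVal_eq_ord hg, K.polyVal_eq_ord (mul_ne_zero hf hg)] at h
  exact_mod_cast h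

theorem Cluster.ord_C (K : Cluster) {c : ℂ} (hc : c ≠ 0) : K.ord (C c) = 0 := by
  have h := K.ord_mul (C_ne_zero.2 hc) (C_ne_zero.2 (inv_ne_zero hc))
  rw [← C_mul, mul_inv_cancel₀ hc] at h
  have h1 := K.ord_mul (one_ne_zero (α := Plane)) one_ne_zero
  rw [mul_one] at h1
  rw [C_1] at h
  omega

theorem Cluster.ord_pow (K : Cluster) {f : Plane} (hf : f ≠ 0) (n : ℕ) :
    K.ord (f ^ n) = n * K.ord f := by
  induction n with
  | zero => simpa using K.ord_C one_ne_zero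
  | succ n ih => rw [pow_succ, K.ord_mul (pow_ne_zero n hf) hf, ih]; ring

/-! ### The colength function -/

/-- The polynomials of value at least `n`. -/
def Cluster.valSub (K : Cluster) (n : ℕ) : Submodule ℂ Plane :=
  (germSub (K.points ++ [.slope 0]) n).comap (coeToMvPowerSeries.algHom ℂ).toLinearMap

theorem coeToMvPowerSeries_toLinearMap_apply (f : Plane) :
    (coeToMvPowerSeries.algHom ℂ : Plane →ₐ[ℂ] Germ).toLinearMap f = (f : Germ) := by
  simp [coeToMvPowerSeries.algHom_apply]

theorem Cluster.mem_valSub (K : Cluster) (q : ExcPoint) {n : ℕ} {f : Plane} :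
    f ∈ K.valSub n ↔ (X 0 : Plane) ^ n ∣ pullback (K.points ++ [q]) f := by
  rw [Cluster.valSub, Submodule.mem_comap, mem_germSub, coeToMvPowerSeries_toLinearMap_apply,
    pullGerm_coe, coe_X_pow_dvd_iff, X_pow_dvd_pullback_append_iff]

theorem Cluster.mem_valSub_iff (K : Cluster) {n : ℕ} {f : Plane} (hf : f ≠ 0) :
    f ∈ K.valSub n ↔ n ≤ K.ord f := by
  rw [K.mem_valSub (.slope 0), K.X_pow_dvd_pullback_iff _ hf]

/-- The colength of the ideal of polynomials of value at least `n`. -/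
def Cluster.colength (K : Cluster) (n : ℕ) : ℕ := Module.finrank ℂ (Plane ⧸ K.valSub n)

theorem Cluster.valSub_eq_comap (K : Cluster) (q : ExcPoint) (n : ℕ) :
    K.valSub n =
      (germSub (K.points ++ [q]) n).comap (coeToMvPowerSeries.algHom ℂ).toLinearMap := by
  ext f
  rw [K.mem_valSub q, Submodule.mem_comap, mem_germSub, coeToMvPowerSeries_toLinearMap_apply,
    pullGerm_coe, coe_X_pow_dvd_iff]

/-- Truncation shows that polynomials fill the quotient of the completion, and the order along the
last curve may be computed at any of its points q. -/
theorem Cluster.colength_eq_germ (K : Cluster) (q : ExcPoint) (n : ℕ) :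
    K.colength n = Module.finrank ℂ (Germ ⧸ germSub (K.points ++ [q]) n) := by
  rw [Cluster.colength, K.valSub_eq_comap q]
  refine finrank_quotient_eq _ _ fun f => ?_
  obtain ⟨p, -, hp⟩ := exists_polynomial_approx f n
  refine ⟨p, ?_⟩
  rw [coeToMvPowerSeries_toLinearMap_apply, mem_germSub]
  exact X_pow_dvd_pullGerm (by simp) hp

theorem Cluster.exists_sub_mem_valSub (K : Cluster) (f : Plane) (n : ℕ) :
    ∃ p : Plane, p.totalDegree ≤ n ∧ f - p ∈ K.valSub n := by
  obtain ⟨p, hp, hpf⟩ := exists_polynomial_approx (f : Germ) n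
  refine ⟨p, hp, ?_⟩
  rw [Cluster.valSub, Submodule.mem_comap, mem_germSub, map_sub,
    coeToMvPowerSeries_toLinearMap_apply, coeToMvPowerSeries_toLinearMap_apply]
  exact X_pow_dvd_pullGerm (by simp) hpf

theorem Cluster.finite_quotient_valSub (K : Cluster) (n : ℕ) :
    Module.Finite ℂ (Plane ⧸ K.valSub n) := by
  refine Module.Finite.of_surjective
    ((K.valSub n).mkQ ∘ₗ (restrictTotalDegree (Fin 2) ℂ n).subtype) fun v => ?_
  obtain ⟨f, rfl⟩ := Submodule.mkQ_surjective _ v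
  obtain ⟨p, hp, hpf⟩ := K.exists_sub_mem_valSub f n
  refine ⟨⟨p, (mem_restrictTotalDegree _ _ _).2 hp⟩, ?_⟩
  rw [LinearMap.comp_apply, eq_comm, Submodule.mkQ_apply, Submodule.mkQ_apply,
    Submodule.Quotient.eq]
  exact hpf

theorem Cluster.colength_zero (K : Cluster) : K.colength 0 = 0 := by
  have : K.valSub 0 = ⊤ := by
    rw [eq_top_iff]
    intro f _
    rw [K.mem_valSub (.slope 0), pow_zero]
    exact one_dvd _
  rw [Cluster.colength, this]
  exact Module.finrank_zero_of_subsingleton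

/-! ### From polynomials to the local ring. -/

theorem mem_primeCompl_iff {s : Plane} :
    s ∈ originIdeal.primeCompl ↔ constantCoeff s ≠ 0 := by
  rw [Ideal.mem_primeCompl_iff, originIdeal, RingHom.mem_ker]

theorem Cluster.val_eq_polyVal (K : Cluster) {x : FunField} {a s : Plane}
    (hs : constantCoeff s ≠ 0)
    (h : x * algebraMap Plane FunField s = algebraMap Plane FunField a) :
    K.val x = K.polyVal a := by
  have h1 := congrArg K.val h
  rwa [K.val.map_mul, K.val_unit (mem_primeCompl_iff.2 hs), add_zero, K.val_algebraMap] at h1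

theorem Cluster.exists_mul_eq (f : localRing) : ∃ a s : Plane, constantCoeff s ≠ 0 ∧
    (f : FunField) * algebraMap Plane FunField s = algebraMap Plane FunField a := by
  obtain ⟨a, s, hs, h⟩ := f.2
  have hs0 : algebraMap Plane FunField s ≠ 0 := by
    rw [Ne, map_eq_zero_iff _ (IsFractionRing.injective Plane FunField)]
    rintro rfl
    exact mem_primeCompl_iff.1 hs (map_zero _)
  refine ⟨a, s, mem_primeCompl_iff.1 hs, ?_⟩
  rw [h, mul_assoc, inv_mul_cancel₀ hs0, mul_one]

theorem Cluster.finrank_quotient_valIdeal (K : Cluster) (n : ℕ) :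
    Module.finrank ℂ (localRing ⧸ K.valIdeal n) = K.colength n := by
  let φ : Plane →ₗ[ℂ] localRing := (IsScalarTower.toAlgHom ℂ Plane localRing).toLinearMap
  have hφ : ∀ p, ((φ p : localRing) : FunField) = algebraMap Plane FunField p := fun p => rfl
  have hmem : ∀ x : localRing, x ∈ (K.valIdeal n).restrictScalars ℂ ↔
      ((n : ℤ) : WithTop ℤ) ≤ K.val (x : FunField) := fun x => Iff.rfl
  have hcomap : K.valSub n = ((K.valIdeal n).restrictScalars ℂ).comap φ := by
    ext p
    rw [Submodule.mem_comap, hmem, hφ, K.val_algebraMap, K.le_polyVal_iff (.slope 0), K.mem_valSub]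
  rw [Cluster.colength, hcomap, finrank_quotient_eq φ]
  · exact (Submodule.Quotient.restrictScalarsEquiv ℂ (K.valIdeal n)).finrank_eq.symm
  · intro w
    -- For w = a/s take a polynomial p close to 1/s. Then (w - ap)s = a(1 - sp) has value at least
    -- n, and s has value 0.
    obtain ⟨a, s, hs, hw⟩ := Cluster.exists_mul_eq w
    obtain ⟨r, hr⟩ := (isUnit_coe_iff.2 hs).exists_right_inv
    obtain ⟨p, -, hp⟩ := exists_polynomial_approx r n
    have h1 : (X 0 : Plane) ^ n ∣ pullback (K.points ++ [.slope 0]) (1 - s * p) := by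
      rw [← coe_X_pow_dvd_iff, ← pullGerm_coe]
      have h2 : ((1 - s * p : Plane) : Germ) = (s : Germ) * (r - (p : Germ)) := by
        rw [mul_sub, hr, ← coeToMvPowerSeries.ringHom_apply, map_sub, map_one, map_mul]
        rfl
      rw [h2, map_mul]
      exact (X_pow_dvd_pullGerm (by simp) hp).mul_left _
    refine ⟨a * p, ?_⟩
    rw [hmem, K.val_eq_polyVal (a := a * (1 - s * p)) hs, K.le_polyVal_iff (.slope 0), map_mul]
    · exact h1.mul_left _
    · have h3 : ((w - φ (a * p) : localRing) : FunField) =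
          (w : FunField) - algebraMap Plane FunField (a * p) := rfl
      rw [h3, sub_mul, hw]
      simp only [map_mul, map_sub, map_one]
      ring

/-! ### Curvettes -/

theorem coeff_single_one_mul (f g : Germ) :
    MvPowerSeries.coeff (Finsupp.single 1 1) (f * g) =
      MvPowerSeries.constantCoeff f * MvPowerSeries.coeff (Finsupp.single 1 1) g +
        MvPowerSeries.coeff (Finsupp.single 1 1) f * MvPowerSeries.constantCoeff g := by
  classical
  rw [MvPowerSeries.coeff_mul, Finsupp.antidiagonal_single, Finset.sum_map,
    Finset.Nat.sum_antidiagonal_eq_sum_range_succ_mk]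
  simp [Finset.sum_range_succ]

theorem constantCoeff_coe (f : Plane) :
    MvPowerSeries.constantCoeff (f : Germ) = constantCoeff f := by
  rw [← MvPowerSeries.coeff_zero_eq_constantCoeff_apply, MvPolynomial.coeff_coe]
  rfl

/-- A polynomial has a smooth strict transform, transversal to `Eₙ` at a general point, if and
only if its total transform is a power of `x` times a transversal germ. -/
theorem Cluster.IsFree.isTransversal_iff {K : Cluster} {q : ExcPoint} (hq : K.IsFree q)
    {a : Plane} :
    (∃ N, IsTransversal (K.points ++ [q]) (a : Germ) N) ↔
      constantCoeff (strictTransform (K.points ++ [q]) a) = 0 ∧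
        coeff (Finsupp.single 1 1) (strictTransform (K.points ++ [q]) a) ≠ 0 := by
  obtain ⟨e, he, h⟩ := pullback_eq_mul_strictTransform (K.points ++ [q]) a
  obtain ⟨n, u, hu, hn⟩ := hq.coe_mem_xMonomial he
  set S := strictTransform (K.points ++ [q]) a with hS
  have hpull : pullGerm (K.points ++ [q]) (a : Germ) = MvPowerSeries.X 0 ^ n * (u * (S : Germ)) := by
    rw [pullGerm_coe, h, MvPolynomial.coe_mul, hn, mul_assoc]
  have hu0 : MvPowerSeries.constantCoeff u ≠ 0 :=
    (MvPowerSeries.isUnit_iff_constantCoeff.1 hu).ne_zero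
  constructor
  · rintro ⟨N, b', hb, hb0, hb1⟩
    have hX0 : (MvPowerSeries.X 0 : Germ) ≠ 0 := by
      rw [← MvPolynomial.coe_X, Ne, MvPolynomial.coe_eq_zero_iff]
      exact X_ne_zero _
    have ha : a ≠ 0 := by
      rintro rfl
      rw [MvPolynomial.coe_zero, map_zero] at hb
      have := (mul_eq_zero.1 hb.symm).resolve_left (pow_ne_zero _ hX0)
      exact hb1 (by rw [this, map_zero])
    have hSx : xord (S : Germ) = 0 := by
      rw [xord_eq_zero_iff, ← pow_one (MvPowerSeries.X 0 : Germ), coe_X_pow_dvd_iff, pow_one]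
      exact not_X_dvd_strictTransform _ _ ha
    -- Neither cofactor is divisible by x, so the exponents agree and b' is a unit times the strict
    -- transform; the unit affects neither vanishing nor the y-coefficient's being nonzero.
    have hord := congrArg xord (hpull.symm.trans hb)
    rw [xord_mul, xord_mul, xord_mul, xord_X_pow, xord_X_pow, xord_of_isUnit hu, hSx,
      xord_eq_zero_iff.2 (not_X_dvd_of_coeff hb1), add_zero, add_zero, add_zero,
      Nat.cast_inj] at hord
    subst hord
    have hb' : b' = u * (S : Germ) := mul_left_cancel₀ (pow_ne_zero _ hX0) (hb.symm.trans hpull)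
    rw [hb', map_mul, constantCoeff_coe] at hb0
    have hS0 := (mul_eq_zero.1 hb0).resolve_left hu0
    rw [hb', coeff_single_one_mul, constantCoeff_coe, hS0, mul_zero, add_zero,
      MvPolynomial.coeff_coe] at hb1
    exact ⟨hS0, right_ne_zero_of_mul hb1⟩
  · rintro ⟨h0, h1⟩
    refine ⟨n, _, hpull, ?_, ?_⟩
    · rw [map_mul, constantCoeff_coe, h0, mul_zero]
    · rw [coeff_single_one_mul, constantCoeff_coe, h0, mul_zero, add_zero, MvPolynomial.coeff_coe]
      exact mul_ne_zero hu0 h1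

theorem isUnit_of_not_X_dvd_pullGerm {l : List ExcPoint} (hl : l ≠ []) {f : Germ}
    (h : ¬ MvPowerSeries.X 0 ∣ pullGerm l f) : IsUnit f := by
  rw [MvPowerSeries.isUnit_iff_constantCoeff, isUnit_iff_ne_zero]
  intro h0
  apply h
  rw [← pow_one (MvPowerSeries.X 0 : Germ)]
  refine X_pow_dvd_pullGerm hl fun d hd => ?_
  obtain rfl : d = 0 := by
    rw [← Finsupp.degree_eq_zero_iff]
    omega
  exact h0

/-- A transversal germ of minimal value is irreducible. -/
theorem irreducible_of_isTransversal {l : List ExcPoint} (hl : l ≠ []) {b : Germ} {N : ℕ}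
    (hb : IsTransversal l b N) (hmin : ∀ c M, IsTransversal l c M → N ≤ M) : Irreducible b := by
  have hinj : (MvPowerSeries.X 0 : Germ) ≠ 0 := by
    rw [← MvPolynomial.coe_X, Ne, MvPolynomial.coe_eq_zero_iff]
    exact X_ne_zero _
  obtain ⟨b', hb, hb0, hb1⟩ := hb
  have hb'x : xord b' = 0 := xord_eq_zero_iff.2 (not_X_dvd_of_coeff hb1)
  have hb'0 : b' ≠ 0 := fun h => hb1 (by rw [h, map_zero])
  have hpb : pullGerm l b ≠ 0 := by
    rw [hb]
    exact mul_ne_zero (pow_ne_zero _ hinj) hb'0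
  -- If b' = c'd' and c' vanishes at the point, the nonzero y-coefficient of b' makes c transversal
  -- of value m. Minimality gives n = 0, so d is a unit.
  have key : ∀ (c d c' d' : Germ) (m n : ℕ), pullGerm l c = MvPowerSeries.X 0 ^ m * c' →
      pullGerm l d = MvPowerSeries.X 0 ^ n * d' → ¬ MvPowerSeries.X 0 ∣ d' → m + n = N → b' = c' * d' →
      MvPowerSeries.constantCoeff c' = 0 → IsUnit d := by
    intro c d c' d' m n hc hd hd' hmn hbc hc0
    rw [hbc, coeff_single_one_mul, hc0, zero_mul, zero_add] at hb1
    have := hmin c m ⟨c', hc, hc0, left_ne_zero_of_mul hb1⟩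
    obtain rfl : n = 0 := by omega
    rw [pow_zero, one_mul] at hd
    exact isUnit_of_not_X_dvd_pullGerm hl (by rwa [hd])
  refine ⟨fun hu => ?_, fun c d hcd => ?_⟩
  · have h1 : IsUnit b' := isUnit_of_mul_isUnit_right (by rw [← hb]; exact hu.map (pullGerm l))
    rw [MvPowerSeries.isUnit_iff_constantCoeff, hb0] at h1
    exact not_isUnit_zero h1
  · rw [hcd, map_mul] at hpb
    obtain ⟨m, c', hc, hc'⟩ := exists_eq_X_pow_mul (left_ne_zero_of_mul hpb)
    obtain ⟨n, d', hd, hd'⟩ := exists_eq_X_pow_mul (right_ne_zero_of_mul hpb)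
    have hprod : MvPowerSeries.X 0 ^ N * b' = MvPowerSeries.X 0 ^ (m + n) * (c' * d') := by
      rw [← hb, hcd, map_mul, hc, hd]
      ring
    have hord := congrArg xord hprod
    rw [xord_mul, xord_mul, xord_mul, xord_X_pow, xord_X_pow, hb'x, xord_eq_zero_iff.2 hc',
      xord_eq_zero_iff.2 hd', add_zero, add_zero, add_zero, Nat.cast_inj] at hord
    rw [hord] at hprod
    have hbc := mul_left_cancel₀ (pow_ne_zero _ hinj) hprod
    rw [hbc, map_mul] at hb0
    rcases mul_eq_zero.1 hb0 with h0 | h0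
    · exact Or.inr (key c d c' d' m n hc hd hd' hord.symm hbc h0)
    · exact Or.inl (key d c d' c' n m hd hc hc' (by omega) (by rw [hbc, mul_comm]) h0)

theorem Cluster.IsFree.exists_isTransversal {K : Cluster} {q : ExcPoint} (hq : K.IsFree q) :
    ∃ (p : Plane) (N : ℕ), IsTransversal (K.points ++ [q]) (p : Germ) N ∧
      Irreducible (p : Germ) := by
  have hne : K.points ++ [q] ≠ [] := by simp
  have hex : ∃ N, ∃ b, IsTransversal (K.points ++ [q]) b N := by
    -- Start from the smooth transversal germ y = 0: multiplied by exceptional equations it descends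
    -- to the plane.
    obtain ⟨f, -, e, he, -, hf⟩ := exists_pullback_eq_mul (K.points ++ [q]) (X 1)
    obtain ⟨n, u, hu, hn⟩ := hq.coe_mem_xMonomial he
    refine ⟨n, f, u * MvPowerSeries.X 1, ?_, by simp, ?_⟩
    · rw [pullGerm_coe, hf, MvPolynomial.coe_mul, hn, coe_X, mul_assoc]
    · rw [coeff_single_one_mul, MvPowerSeries.coeff_X]
      simpa using (MvPowerSeries.isUnit_iff_constantCoeff.1 hu).ne_zero
  classical
  obtain ⟨b, b', hb, hb0, hb1⟩ := Nat.find_spec hex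
  have hmin : ∀ c M, IsTransversal (K.points ++ [q]) c M → Nat.find hex ≤ M := fun c M hc =>
    Nat.find_min' hex ⟨c, hc⟩
  generalize Nat.find hex = N at hb hmin
  -- Truncation at N + 2 changes b' by a multiple of x ^ 2 only, so p is again transversal of the
  -- minimal value N, hence irreducible.
  obtain ⟨p, -, hp⟩ := exists_polynomial_approx b (N + 2)
  obtain ⟨r, hr⟩ := X_pow_dvd_pullGerm hne hp
  have hpt : IsTransversal (K.points ++ [q]) (p : Germ) N := by
    refine ⟨b' - MvPowerSeries.X 0 ^ 2 * r, ?_, by simp [hb0], ?_⟩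
    · have : (p : Germ) = b - (b - (p : Germ)) := by ring
      rw [this, map_sub, hb, hr]
      ring
    · rw [map_sub, coeff_single_one_mul]
      have h2 : MvPowerSeries.coeff (Finsupp.single 1 1) ((MvPowerSeries.X 0 : Germ) ^ 2) = 0 :=
        MvPowerSeries.X_pow_dvd_iff.1 (dvd_refl _) _ (by simp)
      rw [h2]
      simpa using hb1
  exact ⟨p, N, hpt, irreducible_of_isTransversal hne hpt hmin⟩

theorem Cluster.exists_isCurvette (K : Cluster) : ∃ φ : localRing, K.IsCurvette φ := by
  obtain ⟨q, hq⟩ := K.exists_isFree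
  obtain ⟨p, N, hp, hirr⟩ := hq.exists_isTransversal
  obtain ⟨h0, h1⟩ := hq.isTransversal_iff.1 ⟨N, hp⟩
  exact ⟨algebraMap Plane localRing p, p, 1, by simp, by rw [map_one, mul_one]; rfl, hirr, q, hq,
    h0, h1⟩

theorem Cluster.IsCurvette.exists_isTransversal {K : Cluster} {φ : localRing}
    (hφ : K.IsCurvette φ) : ∃ (q : ExcPoint) (a : Plane) (N : ℕ), K.IsFree q ∧
      IsTransversal (K.points ++ [q]) (a : Germ) N ∧ Irreducible (a : Germ) ∧
      K.realVal φ = N := by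
  obtain ⟨a, s, hs, has, hirr, q, hq, h⟩ := hφ
  obtain ⟨N, hN⟩ := hq.isTransversal_iff.2 h
  refine ⟨q, a, N, hq, hN, hirr, ?_⟩
  have ha : a ≠ 0 := by
    rintro rfl
    exact hirr.ne_zero (MvPolynomial.coe_zero)
  have hord : ∀ n, n ≤ K.ord a ↔ n ≤ N := by
    intro n
    obtain ⟨b', hb, -, hb1⟩ := hN
    rw [← K.X_pow_dvd_pullback_iff q ha, ← coe_X_pow_dvd_iff, ← pullGerm_coe,
      X_pow_dvd_iff_le_xord, hb, xord_mul, xord_X_pow,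
      xord_eq_zero_iff.2 (not_X_dvd_of_coeff hb1), add_zero, Nat.cast_le]
  have hN' : K.ord a = N := le_antisymm ((hord _).1 le_rfl) ((hord _).2 le_rfl)
  rw [Cluster.realVal, K.val_eq_polyVal hs has, K.polyVal_eq_ord ha, hN', WithTop.untopD_coe,
    Int.cast_natCast]

theorem IsTransversal.pos {l : List ExcPoint} (hl : l ≠ []) {b : Germ} {N : ℕ}
    (hb : IsTransversal l b N) : 1 ≤ N := by
  by_contra! hN
  obtain rfl : N = 0 := by omega
  obtain ⟨b', hb, hb0, hb1⟩ := hb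
  rw [pow_zero, one_mul] at hb
  have hu := (isUnit_of_not_X_dvd_pullGerm hl (by rw [hb]; exact not_X_dvd_of_coeff hb1)).map
    (pullGerm l)
  rw [hb, MvPowerSeries.isUnit_iff_constantCoeff, hb0] at hu
  exact not_isUnit_zero hu

/-! ### The volume -/

theorem quadratic_growth {H : ℕ → ℝ} {N C : ℕ} (hN : 1 ≤ N) (h0 : H 0 = 0)
    (h : ∀ n, |H n - H (n - N) - n| ≤ C) :
    ∃ C' : ℝ, ∀ n, |H n - (n : ℝ) ^ 2 / (2 * N)| ≤ C' * (n + 1) := by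
  have hN' : (1 : ℝ) ≤ N := by exact_mod_cast hN
  -- A step from m to m + N costs the error C plus N/2, from completing the square. The allowance
  -- grows by N(C + N + 2), which is enough as N ≥ 1.
  refine ⟨C + N + 2, fun n => ?_⟩
  induction n using Nat.strong_induction_on with
  | _ n ih =>
    have hC : (0 : ℝ) ≤ C := Nat.cast_nonneg C
    have hn0 : (0 : ℝ) ≤ n := Nat.cast_nonneg n
    rcases lt_or_ge n N with hlt | hge
    · have h1 := h n
      rw [Nat.sub_eq_zero_of_le hlt.le, h0, sub_zero] at h1
      have h2 : (n : ℝ) ^ 2 / (2 * N) ≤ n := by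
        rw [div_le_iff₀ (by positivity)]
        have : (n : ℝ) ≤ N := by exact_mod_cast hlt.le
        nlinarith
      have h3 : 0 ≤ (n : ℝ) ^ 2 / (2 * N) := by positivity
      rw [abs_le] at h1 ⊢
      constructor <;> nlinarith
    · obtain ⟨m, rfl⟩ := Nat.exists_eq_add_of_le' hge
      have h1 := h (m + N)
      have h2 := ih m (by omega)
      rw [Nat.add_sub_cancel] at h1
      push_cast at h1 hn0 ⊢
      have hm0 : (0 : ℝ) ≤ m := Nat.cast_nonneg m
      have h3 : ((m : ℝ) + N) ^ 2 / (2 * N) = (m : ℝ) ^ 2 / (2 * N) + m + N / 2 := by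
        field_simp
        ring
      rw [h3]
      rw [abs_le] at h1 h2 ⊢
      constructor <;> nlinarith

theorem Cluster.IsFree.colength_growth {K : Cluster} {q : ExcPoint} (hq : K.IsFree q)
    {b : Germ} {N : ℕ} (hb : IsTransversal (K.points ++ [q]) b N) (hirr : Irreducible b) :
    ∃ C : ℝ, ∀ n : ℕ, |(K.colength n : ℝ) - (n : ℝ) ^ 2 / (2 * N)| ≤ C * (n + 1) := by
  have hE : ∀ e ∈ excMonoid (K.points ++ [q]), (e : Germ) ∈ xMonomial := fun e he =>
    hq.coe_mem_xMonomial he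
  have hpos := hb.pos (by simp)
  have hcol : ∀ n, Module.finrank ℂ (Germ ⧸ germSub (K.points ++ [q]) n) = K.colength n :=
    fun n => (K.colength_eq_germ q n).symm
  obtain ⟨t, ts, hl⟩ := List.exists_cons_of_ne_nil (show K.points ++ [q] ≠ [] by simp)
  rw [hl] at hE hb hcol
  obtain ⟨C, hC⟩ := exists_colength_sub_bound hE hb hirr
  simp only [hcol] at hC
  refine quadratic_growth (H := fun n => (K.colength n : ℝ)) (C := C) hpos
    (by simp [K.colength_zero]) fun n => ?_
  obtain ⟨h1, h2⟩ := hC n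
  have h1' : (K.colength n : ℝ) ≤ K.colength (n - N) + n + C := by exact_mod_cast h1
  have h2' : (K.colength (n - N) : ℝ) + n ≤ K.colength n + C := by exact_mod_cast h2
  rw [abs_le]
  constructor <;> linarith

theorem tendsto_of_quadratic_growth {H : ℕ → ℝ} {c C : ℝ}
    (h : ∀ n : ℕ, |H n - (n : ℝ) ^ 2 / (2 * c)| ≤ C * (n + 1)) :
    Tendsto (fun n : ℕ => H n / ((n : ℝ) ^ 2 / 2)) atTop (𝓝 (1 / c)) := by
  rw [tendsto_iff_norm_sub_tendsto_zero]
  have hlim : Tendsto (fun n : ℕ => 4 * |C| / (n : ℝ)) atTop (𝓝 0) :=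
    tendsto_const_div_atTop_nhds_zero_nat _
  refine squeeze_zero' (Eventually.of_forall fun n => norm_nonneg _) ?_ hlim
  filter_upwards [eventually_ge_atTop 1] with n hn
  have hn' : (1 : ℝ) ≤ n := by exact_mod_cast hn
  have hn0 : (0 : ℝ) < (n : ℝ) ^ 2 / 2 := by positivity
  have h1 : H n / ((n : ℝ) ^ 2 / 2) - 1 / c =
      (H n - (n : ℝ) ^ 2 / (2 * c)) / ((n : ℝ) ^ 2 / 2) := by
    rw [sub_div]
    congr 1
    have hne : (n : ℝ) ≠ 0 := by positivity
    rcases eq_or_ne c 0 with rfl | hc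
    · simp
    · field_simp
  rw [h1, Real.norm_eq_abs, abs_div, abs_of_pos hn0, div_le_div_iff₀ hn0 (by positivity)]
  have h2 := h n
  have h3 : C * ((n : ℝ) + 1) ≤ |C| * (2 * n) := by
    refine mul_le_mul (le_abs_self C) (by linarith) (by positivity) (abs_nonneg C)
  nlinarith

theorem Cluster.IsCurvette.colength_growth {K : Cluster} {φ : localRing} (hφ : K.IsCurvette φ) :
    ∃ C : ℝ, ∀ n : ℕ, |(K.colength n : ℝ) - (n : ℝ) ^ 2 / (2 * K.realVal φ)| ≤ C * (n + 1) := by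
  obtain ⟨q, a, N, hq, hN, hirr, hval⟩ := hφ.exists_isTransversal
  rw [hval]
  exact hq.colength_growth hN hirr

theorem Cluster.IsCurvette.one_le_realVal {K : Cluster} {φ : localRing} (hφ : K.IsCurvette φ) :
    1 ≤ K.realVal φ := by
  obtain ⟨q, a, N, hq, hN, hirr, hval⟩ := hφ.exists_isTransversal
  rw [hval]
  exact_mod_cast hN.pos (by simp)

theorem Cluster.volRatio_eq (K : Cluster) (n : ℕ) :
    K.volRatio n = (K.colength n : ℝ) / ((n : ℝ) ^ 2 / 2) := by
  rw [Cluster.volRatio, K.finrank_quotient_valIdeal]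

theorem Cluster.IsCurvette.tendsto_volRatio {K : Cluster} {φ : localRing} (hφ : K.IsCurvette φ) :
    Tendsto K.volRatio atTop (𝓝 (1 / K.realVal φ)) := by
  obtain ⟨C, hC⟩ := hφ.colength_growth
  rw [show K.volRatio = fun n : ℕ => (K.colength n : ℝ) / ((n : ℝ) ^ 2 / 2) from
    funext K.volRatio_eq]
  exact tendsto_of_quadratic_growth hC

/-- The volume ratios converge to 1/ν(φ) for every curvette φ, and they do not involve φ; uniqueness
of limits makes all these values equal. -/
theorem Cluster.IsCurvette.realVal_eq_betaBar {K : Cluster} {φ : localRing}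
    (hφ : K.IsCurvette φ) : K.realVal φ = K.betaBar := by
  have : {b : ℝ | ∃ φ : localRing, K.IsCurvette φ ∧ b = K.realVal φ} = {K.realVal φ} := by
    ext b
    constructor
    · rintro ⟨ψ, hψ, rfl⟩
      have h := tendsto_nhds_unique hψ.tendsto_volRatio hφ.tendsto_volRatio
      rw [one_div, one_div, inv_inj] at h
      exact h
    · rintro rfl
      exact ⟨φ, hφ, rfl⟩
  rw [Cluster.betaBar, this, csInf_singleton]

theorem Cluster.one_le_betaBar (K : Cluster) : 1 ≤ K.betaBar := by
  obtain ⟨φ, hφ⟩ := K.exists_isCurvette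
  rw [← hφ.realVal_eq_betaBar]
  exact hφ.one_le_realVal

theorem Cluster.colength_growth (K : Cluster) :
    ∃ C : ℝ, ∀ n : ℕ, |(K.colength n : ℝ) - (n : ℝ) ^ 2 / (2 * K.betaBar)| ≤ C * (n + 1) := by
  obtain ⟨φ, hφ⟩ := K.exists_isCurvette
  rw [← hφ.realVal_eq_betaBar]
  exact hφ.colength_growth

theorem Cluster.tendsto_volRatio (K : Cluster) :
    Tendsto K.volRatio atTop (𝓝 (1 / K.betaBar)) := by
  obtain ⟨φ, hφ⟩ := K.exists_isCurvette
  rw [← hφ.realVal_eq_betaBar]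
  exact hφ.tendsto_volRatio

theorem Cluster.vol_eq (K : Cluster) : K.vol = 1 / K.betaBar := K.tendsto_volRatio.limUnder_eq


/-! ### Polynomials of bounded degree and Bézout's bound -/

theorem card_degree_le (D : ℕ) :
    2 * Nat.card {s : Fin 2 →₀ ℕ | (s.sum fun _ e => e) ≤ D} = (D + 1) * (D + 2) := by
  have hsum (s : Fin 2 →₀ ℕ) : (s.sum fun _ e => e) = s 0 + s 1 := by
    rw [Finsupp.sum_fintype _ _ fun _ => rfl, Fin.sum_univ_two]
  have e : {s : Fin 2 →₀ ℕ | (s.sum fun _ e => e) ≤ D} ≃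
      ((Finset.range (D + 1)).sigma fun i => Finset.range (i + 1) :
        Finset (Σ _ : ℕ, ℕ)) :=
    { toFun := fun s => ⟨⟨s.1 0 + s.1 1, s.1 0⟩, by
        have h := s.2
        simp only [Set.mem_ofPred_eq, hsum] at h
        simp only [Finset.mem_sigma, Finset.mem_range]
        omega⟩
      invFun := fun p => ⟨Finsupp.equivFunOnFinite.symm ![p.1.2, p.1.1 - p.1.2], by
        have h := p.2
        simp only [Finset.mem_sigma, Finset.mem_range] at h
        simp only [Set.mem_ofPred_eq, hsum]
        simp only [Finsupp.equivFunOnFinite_symm_apply_apply, Matrix.cons_val_zero,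
          Matrix.cons_val_one]
        omega⟩
      left_inv := fun s => by
        ext i
        fin_cases i <;> simp
      right_inv := fun p => by
        have h := p.2
        simp only [Finset.mem_sigma, Finset.mem_range] at h
        ext <;> simp
        omega }
  rw [Nat.card_congr e, Nat.card_eq_fintype_card, Fintype.card_coe, Finset.card_sigma]
  simp only [Finset.card_range]
  clear e
  induction D with
  | zero => simp
  | succ D ih =>
    rw [Finset.sum_range_succ, mul_add, ih]
    ring

/-- The polynomials of degree `≤ D`. -/
abbrev boundedDegree (D : ℕ) : Submodule ℂ Plane := restrictTotalDegree (Fin 2) ℂ D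

theorem finrank_boundedDegree (D : ℕ) :
    2 * Module.finrank ℂ (boundedDegree D) = (D + 1) * (D + 2) := by
  rw [← card_degree_le D]
  congr 1
  exact Module.finrank_eq_nat_card_basis (basisRestrictSupport ℂ _)

/-- Multiplication by `F`, from polynomials of degree `≤ D` to those of degree `≤ E`. -/
def mulRestrict (F : Plane) {D E : ℕ} (h : D + F.totalDegree ≤ E) :
    boundedDegree D →ₗ[ℂ] boundedDegree E :=
  (LinearMap.mulLeft ℂ F).restrict fun p hp => by
    rw [mem_restrictTotalDegree] at hp ⊢
    have := totalDegree_mul F p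
    simp only [LinearMap.mulLeft_apply]
    omega

/-- Bézout's bound: in degree `≤ D`, the ideal of two coprime polynomials `F`, `G` has codimension
at most `deg F * deg G`. -/
theorem exists_bezout_complement {F G : Plane} (hG : G ≠ 0) (hFG : IsRelPrime F G)
    {D : ℕ} (hD : F.totalDegree + G.totalDegree ≤ D) :
    ∃ (k : ℕ) (g : Fin k → Plane), k ≤ F.totalDegree * G.totalDegree ∧
      ∀ v : Plane, v.totalDegree ≤ D →
        ∃ (P Q : Plane) (c : Fin k → ℂ), v = F * P + G * Q + ∑ i, c i • g i := by
  obtain ⟨m, rfl⟩ := Nat.exists_eq_add_of_le hD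
  set a := F.totalDegree with ha
  set b := G.totalDegree with hb
  -- This is the Koszul complex of (F, G) in bounded degree. By coprimality the kernel of `φ`
  -- consists of multiples of (G, -F), and the second difference of (D + 1)(D + 2)/2 is ab.
  let φ : boundedDegree (b + m) × boundedDegree (a + m) →ₗ[ℂ] boundedDegree (a + b + m) :=
    (mulRestrict F (by omega)).coprod (mulRestrict G (by omega))
  let ψ : boundedDegree m →ₗ[ℂ] boundedDegree (b + m) × boundedDegree (a + m) :=
    (mulRestrict G (by omega)).prod (-mulRestrict F (by omega))
  have hker : LinearMap.ker φ ≤ LinearMap.range ψ := by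
    rintro ⟨P, Q⟩ h
    have h0 : F * (P : Plane) + G * Q = 0 := congrArg Subtype.val (LinearMap.mem_ker.1 h)
    have hdvd : G ∣ P := by
      refine hFG.symm.dvd_of_dvd_mul_left ⟨-Q, ?_⟩
      linear_combination h0
    obtain ⟨T, hT⟩ := hdvd
    have hQ : (Q : Plane) = -(F * T) := by
      apply mul_left_cancel₀ hG
      rw [hT] at h0
      linear_combination h0
    have hTm : T.totalDegree ≤ m := by
      rcases eq_or_ne T 0 with rfl | hT0
      · simp
      · have := (mem_restrictTotalDegree _ _ _).1 P.2
        rw [hT, totalDegree_mul_of_isDomain hG hT0] at this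
        omega
    refine ⟨⟨T, (mem_restrictTotalDegree _ _ _).2 hTm⟩, ?_⟩
    ext1
    · exact Subtype.ext hT.symm
    · exact Subtype.ext hQ.symm
  have h1 : Module.finrank ℂ (LinearMap.ker φ) ≤ Module.finrank ℂ (boundedDegree m) :=
    (Submodule.finrank_mono hker).trans (LinearMap.finrank_range_le ψ)
  have h2 := LinearMap.finrank_range_add_finrank_ker φ
  rw [Module.finrank_prod] at h2
  obtain ⟨C, hC⟩ := Submodule.exists_isCompl (LinearMap.range φ)
  have h3 := Submodule.finrank_add_eq_of_isCompl hC
  have d0 := finrank_boundedDegree m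
  have d1 := finrank_boundedDegree (b + m)
  have d2 := finrank_boundedDegree (a + m)
  have d3 := finrank_boundedDegree (a + b + m)
  have : Module.Free ℂ C := Module.Free.of_divisionRing ℂ C
  let B := Module.finBasis ℂ C
  refine ⟨Module.finrank ℂ C, fun i => ((B i : boundedDegree (a + b + m)) : Plane), ?_, fun v hv => ?_⟩
  · zify at *
    nlinarith
  · have hmem : (⟨v, (mem_restrictTotalDegree _ _ _).2 hv⟩ : boundedDegree (a + b + m)) ∈ LinearMap.range φ ⊔ C := by
      rw [hC.sup_eq_top]
      trivial
    obtain ⟨_, ⟨⟨P, Q⟩, rfl⟩, y, hy, h⟩ := Submodule.mem_sup.1 hmem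
    refine ⟨P, Q, B.repr ⟨y, hy⟩, ?_⟩
    have hsum := congrArg (fun z : C => ((z : boundedDegree (a + b + m)) : Plane)) (B.sum_repr ⟨y, hy⟩)
    have h' := congrArg Subtype.val h
    simp only [Submodule.coe_sum, Submodule.coe_smul] at hsum
    rw [hsum]
    exact h'.symm

/-! ### The Bézout inequality for values. -/

theorem Cluster.mul_mem_valSub (K : Cluster) {f g : Plane} (hf : f ≠ 0) {n : ℕ}
    (hg : g ∈ K.valSub n) : f * g ∈ K.valSub (K.ord f + n) := by
  rcases eq_or_ne g 0 with rfl | hg0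
  · simp
  · rw [K.mem_valSub_iff hg0] at hg
    rw [K.mem_valSub_iff (mul_ne_zero hf hg0), K.ord_mul hf hg0]
    omega

theorem Cluster.colength_add_le (K : Cluster) {F G : Plane} (hF : F ≠ 0) (hG : G ≠ 0)
    (hFG : IsRelPrime F G) :
    K.colength (K.ord F + K.ord G) ≤
      K.colength (K.ord F) + K.colength (K.ord G) + F.totalDegree * G.totalDegree := by
  set α := K.ord F + K.ord G with hα
  obtain ⟨k, g, hk, hg⟩ := exists_bezout_complement hG hFG
    -- Degree α suffices to represent every class modulo value α; the other summands make the Bézout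
    -- count available.
    (D := α + (F.totalDegree + G.totalDegree)) (by omega)
  have := K.finite_quotient_valSub (K.ord F)
  have := K.finite_quotient_valSub (K.ord G)
  have h := finrank_quotient_le (K.valSub α) (K.valSub (K.ord G)) (K.valSub (K.ord F))
    (LinearMap.mulLeft ℂ F) (LinearMap.mulLeft ℂ G) g
    (fun p hp => K.mul_mem_valSub hF hp)
    (fun p hp => by
      have := K.mul_mem_valSub hG hp
      rwa [add_comm] at this)
    (fun v => by
      obtain ⟨p, hp, hv⟩ := K.exists_sub_mem_valSub v α
      obtain ⟨P, Q, c, h⟩ := hg p (by omega)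
      refine ⟨P, Q, c, ?_⟩
      simp only [LinearMap.mulLeft_apply]
      rwa [← h])
  rw [Fintype.card_fin] at h
  unfold Cluster.colength
  omega

/-- Two coprime polynomials satisfy a Bézout type inequality for their values. -/
theorem Cluster.ord_mul_ord_le (K : Cluster) {f g : Plane} (hf : f ≠ 0) (hg : g ≠ 0)
    (hfg : IsRelPrime f g) :
    (K.ord f : ℝ) * K.ord g ≤ K.betaBar * (f.totalDegree * g.totalDegree) := by
  obtain ⟨C, hC⟩ := K.colength_growth
  have hβ : 0 < K.betaBar := lt_of_lt_of_le one_pos K.one_le_betaBar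
  set A : ℝ := (K.ord f : ℝ) with hA
  set B : ℝ := (K.ord g : ℝ) with hB
  set a : ℝ := (f.totalDegree : ℝ)
  set b : ℝ := (g.totalDegree : ℝ)
  -- For fⁿ and gⁿ the squares cancel and the cross term n²AB/β remains; the three errors add up to
  -- something linear in n, which forces AB/β ≤ ab.
  have key : ∀ n : ℕ, (n : ℝ) ^ 2 * (A * B / K.betaBar - a * b) ≤
      C * (2 * n * (A + B) + 3) := by
    intro n
    have h := K.colength_add_le (pow_ne_zero n hf) (pow_ne_zero n hg) hfg.pow
    rw [K.ord_pow hf, K.ord_pow hg] at h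
    have hdf : (f ^ n).totalDegree ≤ n * f.totalDegree := totalDegree_pow f n
    have hdg : (g ^ n).totalDegree ≤ n * g.totalDegree := totalDegree_pow g n
    have h' := h.trans (Nat.add_le_add_left (Nat.mul_le_mul hdf hdg) _)
    have h'' : (K.colength (n * K.ord f + n * K.ord g) : ℝ) ≤
      K.colength (n * K.ord f) + K.colength (n * K.ord g) + n * a * (n * b) := by
      have := (Nat.cast_le (α := ℝ)).2 h'
      push_cast at this
      exact this
    have h1 := (abs_le.1 (hC (n * K.ord f + n * K.ord g))).1
    have h2 := (abs_le.1 (hC (n * K.ord f))).2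
    have h3 := (abs_le.1 (hC (n * K.ord g))).2
    push_cast at h1 h2 h3
    rw [← hA, ← hB] at *
    have e : (n * A + n * B) ^ 2 / (2 * K.betaBar) = (n * A) ^ 2 / (2 * K.betaBar) +
        (n * B) ^ 2 / (2 * K.betaBar) + n ^ 2 * (A * B / K.betaBar) := by
      field_simp
      ring
    linarith
  have hle : A * B / K.betaBar - a * b ≤ 0 := by
    by_contra! hpos
    set δ := A * B / K.betaBar - a * b with hδ
    have hlim : Tendsto (fun n : ℕ => (n : ℝ) * δ) atTop atTop :=
      tendsto_natCast_atTop_atTop.atTop_mul_const hpos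
    obtain ⟨n, hn, hn1⟩ := ((hlim.eventually_gt_atTop (|C| * (2 * (A + B) + 3))).and
      (eventually_ge_atTop 1)).exists
    have hn1' : (1 : ℝ) ≤ n := by exact_mod_cast hn1
    have h := key n
    have hA0 : 0 ≤ A := Nat.cast_nonneg _
    have hB0 : 0 ≤ B := Nat.cast_nonneg _
    have h4 : C * (2 * n * (A + B) + 3) ≤ |C| * (n * (2 * (A + B) + 3)) := by
      refine mul_le_mul (le_abs_self C) (by nlinarith) (by positivity) (abs_nonneg C)
    nlinarith
  rw [sub_nonpos, div_le_iff₀ hβ] at hle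
  linarith


/-! ### The invariant `μ̂` -/

theorem totalDegree_chart_le (t : ExcPoint) (f : Plane) :
    (chart t f).totalDegree ≤ 2 * f.totalDegree := by
  have h : ∀ i, (chart t (X i)).totalDegree ≤ 2 := by
    intro i
    cases t with
    | slope c =>
      fin_cases i
      · simp [chart]
      · simp only [chart, Fin.mk_one, aeval_X, Matrix.cons_val_one, Matrix.cons_val_zero]
        refine (totalDegree_mul _ _).trans ?_
        have := totalDegree_add (X 1 : Plane) (C c)
        simp only [totalDegree_X, totalDegree_C] at *
        omega
    | vertical =>
      fin_cases i
      · simp only [chart, Fin.zero_eta, aeval_X, Matrix.cons_val_zero]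
        refine (totalDegree_mul _ _).trans ?_
        simp
      · simp [chart]
  have hchart : chart t f = aeval (fun i => chart t (X i)) f := by
    rw [← comp_aeval_apply, aeval_X_left_apply]
  rw [hchart, aeval_def, eval₂_eq']
  refine totalDegree_finsetSum_le fun d hd => ?_
  refine (totalDegree_mul _ _).trans ?_
  rw [algebraMap_eq, totalDegree_C, zero_add]
  refine (totalDegree_finsetProd _ _).trans ?_
  have hd' : (d.sum fun _ e => e) ≤ f.totalDegree := le_totalDegree hd
  rw [Finsupp.sum_fintype _ _ fun _ => rfl] at hd'
  calc ∑ i, (chart t (X i) ^ d i).totalDegree ≤ ∑ i, 2 * d i := by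
        refine Finset.sum_le_sum fun i _ => (totalDegree_pow _ _).trans ?_
        rw [mul_comm]
        exact Nat.mul_le_mul_right _ (h i)
    _ ≤ 2 * f.totalDegree := by
        rw [← Finset.mul_sum]
        omega

theorem totalDegree_pullback_le (l : List ExcPoint) (f : Plane) :
    (pullback l f).totalDegree ≤ 2 ^ l.length * f.totalDegree := by
  induction l generalizing f with
  | nil => simp [pullback]
  | cons t ts ih =>
    calc (pullback ts (chart t f)).totalDegree ≤ 2 ^ ts.length * (chart t f).totalDegree := ih _
      _ ≤ 2 ^ ts.length * (2 * f.totalDegree) := Nat.mul_le_mul_left _ (totalDegree_chart_le t f)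
      _ = 2 ^ (t :: ts).length * f.totalDegree := by
        rw [List.length_cons, pow_succ, mul_assoc]

/-- Each chart is quadratic, so the total transform has degree at most 2^n deg f. This crude bound
makes the maxima `mu d` exist and μ̂ finite. -/
theorem Cluster.ord_le (K : Cluster) {f : Plane} (hf : f ≠ 0) :
    K.ord f ≤ 2 ^ (K.points.length + 1) * f.totalDegree := by
  have h := (K.X_pow_dvd_pullback_iff (.slope 0) hf (n := K.ord f)).2 le_rfl
  have h0 : pullback (K.points ++ [.slope 0]) f ≠ 0 := by
    rwa [Ne, map_eq_zero_iff _ (pullback_injective _)]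
  have h1 := totalDegree_le_of_dvd_of_isDomain h h0
  rw [totalDegree_X_pow] at h1
  refine h1.trans ((totalDegree_pullback_le _ _).trans_eq ?_)
  simp

theorem Cluster.mu_set_finite (K : Cluster) (d : ℕ) :
    {m : ℝ | ∃ f : Plane, f ≠ 0 ∧ f.totalDegree ≤ d ∧ m = K.valPoly f}.Finite := by
  refine ((Set.finite_Iic (2 ^ (K.points.length + 1) * d)).image (Nat.cast : ℕ → ℝ)).subset ?_
  rintro _ ⟨f, hf, hd, rfl⟩
  exact ⟨K.ord f, (K.ord_le hf).trans (Nat.mul_le_mul_left _ hd), (K.valPoly_eq_ord hf).symm⟩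

theorem Cluster.valPoly_le_mu (K : Cluster) {f : Plane} (hf : f ≠ 0) {d : ℕ}
    (hd : f.totalDegree ≤ d) : K.valPoly f ≤ K.mu d :=
  le_csSup (K.mu_set_finite d).bddAbove ⟨f, hf, hd, rfl⟩

theorem Cluster.exists_valPoly_eq_mu (K : Cluster) (d : ℕ) :
    ∃ f : Plane, f ≠ 0 ∧ f.totalDegree ≤ d ∧ K.mu d = K.valPoly f :=
  Set.Nonempty.csSup_mem (s := {m : ℝ | ∃ f : Plane, f ≠ 0 ∧ f.totalDegree ≤ d ∧ m = K.valPoly f})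
    ⟨_, 1, one_ne_zero, by simp, rfl⟩ (K.mu_set_finite d)

theorem Cluster.valPoly_mul (K : Cluster) {f g : Plane} (hf : f ≠ 0) (hg : g ≠ 0) :
    K.valPoly (f * g) = K.valPoly f + K.valPoly g := by
  rw [K.valPoly_eq_ord hf, K.valPoly_eq_ord hg, K.valPoly_eq_ord (mul_ne_zero hf hg),
    K.ord_mul hf hg, Nat.cast_add]

theorem Cluster.subadditive_neg_mu (K : Cluster) : Subadditive fun d => -K.mu d := by
  intro m n
  obtain ⟨f, hf, hfm, hfe⟩ := K.exists_valPoly_eq_mu m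
  obtain ⟨g, hg, hgn, hge⟩ := K.exists_valPoly_eq_mu n
  have h := K.valPoly_le_mu (mul_ne_zero hf hg)
    ((totalDegree_mul f g).trans (Nat.add_le_add hfm hgn))
  rw [K.valPoly_mul hf hg, ← hfe, ← hge] at h
  linarith

theorem Cluster.mu_div_le (K : Cluster) {κ : ℝ} (hκ : 0 ≤ κ)
    (h : ∀ f : Plane, f ≠ 0 → K.valPoly f ≤ κ * f.totalDegree) (d : ℕ) : K.mu d / d ≤ κ := by
  obtain ⟨f, hf, hfd, hfe⟩ := K.exists_valPoly_eq_mu d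
  have hfd' : (f.totalDegree : ℝ) ≤ d := by exact_mod_cast hfd
  rw [hfe]
  exact div_le_of_le_mul₀ (Nat.cast_nonneg d) hκ
    ((h f hf).trans (mul_le_mul_of_nonneg_left hfd' hκ))

theorem Cluster.bddBelow_neg_mu_div (K : Cluster) :
    BddBelow (Set.range fun d : ℕ => -K.mu d / d) := by
  refine ⟨-2 ^ (K.points.length + 1), ?_⟩
  rintro _ ⟨d, rfl⟩
  have := K.mu_div_le (κ := 2 ^ (K.points.length + 1)) (by positivity)
    (fun f hf => by
      rw [K.valPoly_eq_ord hf]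
      exact_mod_cast K.ord_le hf) d
  change _ ≤ -K.mu d / d
  rw [neg_div]
  linarith

/-- Fekete's lemma: multiplying optimal polynomials makes `mu` superadditive. -/
theorem Cluster.tendsto_mu_div (K : Cluster) :
    Tendsto (fun d : ℕ => K.mu d / d) atTop (𝓝 K.muHat) := by
  have h := (K.subadditive_neg_mu.tendsto_lim K.bddBelow_neg_mu_div).neg
  simp only [neg_div, neg_neg] at h
  exact tendsto_nhds_limUnder ⟨_, h⟩

theorem Cluster.valPoly_le_muHat_mul (K : Cluster) {f : Plane} (hf : f ≠ 0) :
    K.valPoly f ≤ K.muHat * f.totalDegree := by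
  have h := K.tendsto_mu_div
  rcases Nat.eq_zero_or_pos f.totalDegree with h0 | h0
  · have := K.ord_le hf
    rw [K.valPoly_eq_ord hf, h0]
    rw [h0, mul_zero, Nat.le_zero] at this
    simp [this]
  · have hd : (0 : ℝ) < f.totalDegree := by exact_mod_cast h0
    rw [← div_le_iff₀ hd]
    -- The powers of f show that `mu d / d` is at least ν(f)/deg f along the multiples of deg f.
    have hsub : Tendsto (fun n : ℕ => n * f.totalDegree) atTop atTop :=
      tendsto_id.atTop_mul_const' h0
    refine ge_of_tendsto (h.comp hsub) ?_
    filter_upwards [eventually_ge_atTop 1] with n hn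
    have hn' : (0 : ℝ) < n := by exact_mod_cast hn
    have h1 := K.valPoly_le_mu (pow_ne_zero n hf) (totalDegree_pow f n)
    rw [K.valPoly_eq_ord (pow_ne_zero n hf), K.ord_pow hf, Nat.cast_mul,
      ← K.valPoly_eq_ord hf] at h1
    simp only [Function.comp_apply, Nat.cast_mul]
    rw [div_le_div_iff₀ hd (by positivity)]
    nlinarith

theorem Cluster.muHat_le (K : Cluster) {κ : ℝ} (hκ : 0 ≤ κ)
    (h : ∀ f : Plane, f ≠ 0 → K.valPoly f ≤ κ * f.totalDegree) : K.muHat ≤ κ :=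
  le_of_tendsto K.tendsto_mu_div (Eventually.of_forall fun d => K.mu_div_le hκ h d)

theorem Cluster.muHat_nonneg (K : Cluster) : 0 ≤ K.muHat := by
  refine ge_of_tendsto K.tendsto_mu_div (Eventually.of_forall fun d => ?_)
  obtain ⟨f, hf, -, hfe⟩ := K.exists_valPoly_eq_mu d
  rw [hfe, K.valPoly_eq_ord hf]
  positivity

/-! ### The lower bound for μ̂ by counting dimensions. -/

theorem Cluster.exists_le_ord (K : Cluster) {d n : ℕ}
    (h : 2 * K.colength n < (d + 1) * (d + 2)) :
    ∃ f : Plane, f ≠ 0 ∧ f.totalDegree ≤ d ∧ n ≤ K.ord f := by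
  have := K.finite_quotient_valSub n
  have hlt : Module.finrank ℂ (Plane ⧸ K.valSub n) < Module.finrank ℂ (boundedDegree d) := by
    have := finrank_boundedDegree d
    unfold Cluster.colength at h
    omega
  let φ : boundedDegree d →ₗ[ℂ] Plane ⧸ K.valSub n :=
    (K.valSub n).mkQ.comp (boundedDegree d).subtype
  obtain ⟨f, hf, hf0⟩ := (Submodule.ne_bot_iff _).1 (LinearMap.ker_ne_bot_of_finrank_lt (f := φ) hlt)
  have hne : (f : Plane) ≠ 0 := fun h => hf0 (Subtype.ext h)
  refine ⟨f, hne, (mem_restrictTotalDegree _ _ _).1 f.2, ?_⟩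
  rw [← K.mem_valSub_iff hne]
  exact (Submodule.Quotient.mk_eq_zero _).1 (LinearMap.mem_ker.1 hf)

theorem Cluster.sqrt_betaBar_le_muHat (K : Cluster) : √K.betaBar ≤ K.muHat := by
  have hβ : 0 < K.betaBar := lt_of_lt_of_le one_pos K.one_le_betaBar
  rw [Real.sqrt_le_left K.muHat_nonneg]
  by_contra! hlt
  obtain ⟨C, hC⟩ := K.colength_growth
  have hm := K.muHat_nonneg
  set β := K.betaBar
  set m := K.muHat
  set M : ℝ := (2 * m + 1) + β * (2 * |C| * (m + 2)) with hM
  have key : ∀ d : ℕ, 1 ≤ d → (d : ℝ) * (β - m ^ 2) ≤ M := by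
    intro d hd
    have hd' : (1 : ℝ) ≤ d := by exact_mod_cast hd
    -- The least integer above μ̂d: no polynomial of degree at most d has value n, so the colength
    -- at n, about μ̂²d²/(2β), is at least (d + 1)(d + 2)/2. `M` collects the linear errors.
    set n := ⌊m * d⌋₊ + 1 with hn
    have hn1 : m * d < n := by
      rw [hn]
      push_cast
      exact Nat.lt_floor_add_one _
    have hn2 : (n : ℝ) ≤ m * d + 1 := by
      rw [hn]
      push_cast
      linarith [Nat.floor_le (show 0 ≤ m * d by positivity)]
    have hcol : (d + 1) * (d + 2) ≤ 2 * K.colength n := by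
      by_contra! h
      obtain ⟨f, hf, hfd, hfn⟩ := K.exists_le_ord h
      have h1 := K.valPoly_le_muHat_mul hf
      rw [K.valPoly_eq_ord hf] at h1
      have hfd' : (f.totalDegree : ℝ) ≤ d := by exact_mod_cast hfd
      have hfn' : (n : ℝ) ≤ K.ord f := by exact_mod_cast hfn
      have := mul_le_mul_of_nonneg_left hfd' hm
      linarith
    have hcol' : ((d : ℝ) + 1) * (d + 2) ≤ 2 * K.colength n := by exact_mod_cast hcol
    have h2 := (abs_le.1 (hC n)).2
    have h3 : C * ((n : ℝ) + 1) ≤ |C| * ((m + 2) * d) := by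
      refine mul_le_mul (le_abs_self C) (by nlinarith) (by positivity) (abs_nonneg C)
    have h4 : (n : ℝ) ^ 2 ≤ (m * d + 1) ^ 2 := by gcongr
    have h5 : β * ((n : ℝ) ^ 2 / (2 * β)) = n ^ 2 / 2 := by
      field_simp
    have h6 : β * K.colength n ≤ n ^ 2 / 2 + β * (|C| * ((m + 2) * d)) := by
      rw [← h5, ← mul_add]
      exact mul_le_mul_of_nonneg_left (by linarith) hβ.le
    have h7 : β * (d : ℝ) ^ 2 ≤ β * (2 * K.colength n) :=
      mul_le_mul_of_nonneg_left (by nlinarith) hβ.le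
    refine le_of_mul_le_mul_left ?_ (show (0 : ℝ) < d by linarith)
    rw [hM]
    nlinarith
  have hlim : Tendsto (fun d : ℕ => (d : ℝ) * (β - m ^ 2)) atTop atTop :=
    tendsto_natCast_atTop_atTop.atTop_mul_const (by linarith)
  obtain ⟨d, hd, hd1⟩ := ((hlim.eventually_gt_atTop M).and (eventually_ge_atTop 1)).exists
  exact (key d hd1).not_gt hd

/-! ### Existence and uniqueness of the supraminimal curve. -/

theorem irreducible_totalDegree_pos {f : Plane} (hf : Irreducible f) : 0 < f.totalDegree := by
  rw [Nat.pos_iff_ne_zero]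
  intro h0
  rw [totalDegree_eq_zero_iff_eq_C] at h0
  have hc : coeff 0 f ≠ 0 := by
    intro hc
    rw [hc, C_0] at h0
    exact hf.ne_zero h0
  apply hf.not_isUnit
  rw [h0]
  exact (isUnit_iff_ne_zero.2 hc).map C

theorem exists_eq_C_mul_of_associated {f h : Plane} (hfh : Associated f h) :
    ∃ c : ℂ, c ≠ 0 ∧ h = C c * f := by
  obtain ⟨u, rfl⟩ := hfh
  obtain ⟨c, hc, hu⟩ := MvPolynomial.isUnit_iff_eq_C_of_isReduced.1 u.isUnit
  exact ⟨c, hc.ne_zero, by rw [hu, mul_comm]⟩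

/-- Two distinct irreducible curves cannot both have large value. -/
theorem Cluster.associated_of_lt (K : Cluster) {f h : Plane} (hf : Irreducible f)
    (hh : Irreducible h)
    (hlt : K.betaBar * (f.totalDegree * h.totalDegree) < K.valPoly f * K.valPoly h) :
    Associated f h := by
  by_contra hn
  have hrel : IsRelPrime f h := by
    rw [hf.isRelPrime_iff_not_dvd]
    exact fun hd => hn (hf.associated_of_dvd hh hd)
  have := K.ord_mul_ord_le hf.ne_zero hh.ne_zero hrel
  rw [K.valPoly_eq_ord hf.ne_zero, K.valPoly_eq_ord hh.ne_zero] at hlt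
  linarith

/-- A bound for the values of irreducible polynomials extends to all polynomials. -/
theorem Cluster.valPoly_le_of_irreducible (K : Cluster) {κ : ℝ}
    (h : ∀ f : Plane, Irreducible f → K.valPoly f ≤ κ * f.totalDegree) {g : Plane} (hg : g ≠ 0) :
    K.valPoly g ≤ κ * g.totalDegree := by
  induction g using WfDvdMonoid.induction_on_irreducible with
  | zero => exact absurd rfl hg
  | unit u hu =>
    obtain ⟨c, hc, rfl⟩ := MvPolynomial.isUnit_iff_eq_C_of_isReduced.1 hu
    rw [K.valPoly_eq_ord hg, K.ord_C hc.ne_zero, totalDegree_C]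
    simp
  | mul a i ha hi ih =>
    rw [K.valPoly_mul hi.ne_zero ha, totalDegree_mul_of_isDomain hi.ne_zero ha]
    have := ih ha
    have := h i hi
    push_cast
    linarith

/-- For an irreducible i not associated to f, the Bézout inequality gives ν(i)/deg i ≤ β deg f/ν(f),
which is below √β and so below ν(f)/deg f. Thus f bounds all irreducibles, hence all polynomials. -/
theorem Cluster.valPoly_div_eq_muHat (K : Cluster) {f : Plane} (hf : Irreducible f)
    (hlt : K.valPoly f > √K.betaBar * f.totalDegree) :
    K.valPoly f / f.totalDegree = K.muHat := by
  have hβ : 0 < K.betaBar := lt_of_lt_of_le one_pos K.one_le_betaBar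
  have hd : (0 : ℝ) < f.totalDegree := by exact_mod_cast irreducible_totalDegree_pos hf
  have hpos : 0 < K.valPoly f := lt_of_le_of_lt (by positivity) hlt
  refine le_antisymm ((div_le_iff₀ hd).2 (K.valPoly_le_muHat_mul hf.ne_zero))
    (K.muHat_le (by positivity) fun g hg => K.valPoly_le_of_irreducible (fun i hi => ?_) hg)
  rw [div_mul_eq_mul_div, le_div_iff₀ hd]
  by_cases hass : Associated f i
  · obtain ⟨c, hc, rfl⟩ := exists_eq_C_mul_of_associated hass
    have hC : (C c : Plane) ≠ 0 := (C_ne_zero).2 hc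
    rw [K.valPoly_mul hC hf.ne_zero, totalDegree_mul_of_isDomain hC hf.ne_zero,
      K.valPoly_eq_ord hC, K.ord_C hc, totalDegree_C]
    simp
  · have h1 := not_lt.1 (mt (K.associated_of_lt hf hi) hass)
    have hid : (0 : ℝ) ≤ i.totalDegree := Nat.cast_nonneg _
    have hs : √K.betaBar * √K.betaBar = K.betaBar := Real.mul_self_sqrt hβ.le
    have hsp : 0 < √K.betaBar := Real.sqrt_pos.2 hβ
    refine le_of_mul_le_mul_left ?_ hpos
    calc K.valPoly f * (K.valPoly i * f.totalDegree)
        ≤ K.betaBar * (f.totalDegree * i.totalDegree) * f.totalDegree := by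
          rw [← mul_assoc]
          exact mul_le_mul_of_nonneg_right h1 hd.le
      _ = (√K.betaBar * f.totalDegree) * (√K.betaBar * f.totalDegree) * i.totalDegree := by
          rw [mul_mul_mul_comm, hs]
          ring
      _ ≤ K.valPoly f * K.valPoly f * i.totalDegree := by
          gcongr
      _ = K.valPoly f * (K.valPoly f * i.totalDegree) := by ring

theorem Cluster.sqrt_betaBar_lt_muHat (K : Cluster) (h : ¬ K.IsMinimal) :
    √K.betaBar < K.muHat := by
  refine lt_of_le_of_ne K.sqrt_betaBar_le_muHat fun he => h ?_
  rw [Cluster.IsMinimal, K.vol_eq, one_div_one_div, he]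

theorem Cluster.exists_supraminimal (K : Cluster) (h : ¬ K.IsMinimal) :
    ∃ f : Plane, Irreducible f ∧ K.valPoly f > √K.betaBar * f.totalDegree := by
  by_contra! hle
  exact (K.sqrt_betaBar_lt_muHat h).not_ge (K.muHat_le (Real.sqrt_nonneg _)
    fun g hg => K.valPoly_le_of_irreducible hle hg)

/-- The product of the two strict inequalities contradicts the Bézout inequality for coprime curves.
-/
theorem Cluster.associated_of_supraminimal (K : Cluster) {f h : Plane} (hf : Irreducible f)
    (hh : Irreducible h) (hfv : K.valPoly f > √K.betaBar * f.totalDegree)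
    (hhv : K.valPoly h > √K.betaBar * h.totalDegree) : Associated f h := by
  refine K.associated_of_lt hf hh ?_
  have hβ : 0 < K.betaBar := lt_of_lt_of_le one_pos K.one_le_betaBar
  calc K.betaBar * (f.totalDegree * h.totalDegree)
      = (√K.betaBar * f.totalDegree) * (√K.betaBar * h.totalDegree) := by
        rw [mul_mul_mul_comm, Real.mul_self_sqrt hβ.le]
    _ < K.valPoly f * K.valPoly h := mul_lt_mul'' hfv hhv (by positivity) (by positivity)

end PlaneVal

end

/-- `K` is the sequence of centres defining the divisorial valuation `ν`. The first three clauses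
say that the invariants occurring in the statement are well defined. -/
theorem lemma3p6 (K : PlaneVal.Cluster) :
    (∃ φ : PlaneVal.localRing, K.IsCurvette φ ∧ K.realVal φ = K.betaBar) ∧
    Tendsto K.volRatio atTop (𝓝 K.vol) ∧
    Tendsto (fun d : ℕ => K.mu d / d) atTop (𝓝 K.muHat) ∧
    (∀ f : PlaneVal.Plane, Irreducible f → K.valPoly f > √K.betaBar * (f.totalDegree : ℝ) →
      K.valPoly f / (f.totalDegree : ℝ) = K.muHat) ∧
    (¬ K.IsMinimal →
      ∃ f : PlaneVal.Plane, Irreducible f ∧ K.valPoly f > √K.betaBar * (f.totalDegree : ℝ) ∧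
        K.valPoly f / (f.totalDegree : ℝ) = K.muHat ∧
        ∀ h : PlaneVal.Plane, Irreducible h →
          (K.valPoly h > √K.betaBar * (h.totalDegree : ℝ) ∨
            K.valPoly h / (h.totalDegree : ℝ) = K.muHat) →
          ∃ c : ℂ, c ≠ 0 ∧ h = MvPolynomial.C c * f) := by
  refine ⟨?_, ?_, K.tendsto_mu_div, fun f => K.valPoly_div_eq_muHat, fun hmin => ?_⟩
  · obtain ⟨φ, hφ⟩ := K.exists_isCurvette
    exact ⟨φ, hφ, hφ.realVal_eq_betaBar⟩
  · rw [K.vol_eq]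
    exact K.tendsto_volRatio
  · obtain ⟨f, hf, hfv⟩ := K.exists_supraminimal hmin
    refine ⟨f, hf, hfv, K.valPoly_div_eq_muHat hf hfv, fun h hh hhv => ?_⟩
    refine PlaneVal.exists_eq_C_mul_of_associated
      (K.associated_of_supraminimal hf hh hfv (hhv.elim id fun he => ?_))
    have hd : (0 : ℝ) < h.totalDegree := by
      exact_mod_cast PlaneVal.irreducible_totalDegree_pos hh
    -- A curve realizing μ̂ also exceeds √β, because √β < μ̂ in the non-minimal case.
    rw [gt_iff_lt, ← lt_div_iff₀ hd, he]
    exact K.sqrt_betaBar_lt_muHat hmin
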